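/- **Setting.** Let $\mathcal X$ be a measurable space, $\mathcal Z=\mathcal X\times\mathbb R$, let $K,T,n\ge 1$ be integers, and let $\ell:\mathbb R\times\mathbb R\to[0,1]$ be a measurable loss that is $1$-Lipschitz in its first argument. Let $\mathcal H$ be a class of measurable maps $h:\mathcal X\to\mathbb R^K$ and let $\mathcal F$ be a class of functions $f:\mathbb R^K\to\mathbb R$ with Euclidean Lipschitz constant at most $L>0$; to make suprema over $\mathcal H$ measurable, $\mathcal H$ is assumed to contain a countable subset that is dense in it for pointwise convergence. Let $\eta$ be an environment, that is, a probability measure on the set of probability measures on $\mathcal Z$. Put $$\mu_\eta(A)=\mathbb E_{\mu\sim\eta}[\mu(A)]\quad(A\subseteq\mathcal Z),\qquad \rho_\eta(A)=\mathbb E_{\mu\sim\eta}[\mu^n(A)]\quad(A\subseteq\mathcal Z^n).$$ The data are a multisample $\bar{\mathbf Z}=(\mathbf Z_1,\dots,\mathbf Z_T)\sim\rho_\eta^T$ with $\mathbf Z_t=((X_{t1},Y_{t1}),\dots,(X_{tn},Y_{tn}))$ and $\mathbf X_t=(X_{t1},\dots,X_{tn})$. Let $\hat h$ be a solution of multitask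 representation learning: $\hat h\in\mathcal H$ and, for some $\hat f_1,\dots,\hat f_T\in\mathcal F$, $(\hat h,\hat f_1,\dots,\hat f_T)$ minimizes $\frac1{nT}\sum_{t=1}^T\sum_{i=1}^n\ell(f_t(h(X_{ti})),Y_{ti})$ over $h\in\mathcal H$ and $(f_1,\dots,f_T)\in\mathcal F^T$. For $h\in\mathcal H$ and $\mathbf Z=((X_i,Y_i))_{i\le n}\in\mathcal Z^n$ let $\hat f_{h,\mathbf Z}\in\mathcal F$ be a minimizer, chosen measurably in $\mathbf Z$, of $f\mapsto\frac1n\sum_{i=1}^n\ell(f(h(X_i)),Y_i)$ over $\mathcal F$ (assumed to exist), and define $$\mathcal E_\eta(h)=\mathbb E_{\mu\sim\eta}\,\mathbb E_{\mathbf Z\sim\mu^n}\,\mathbb E_{(X,Y)\sim\mu}\big[\ell(\hat f_{h,\mathbf Z}(h(X)),Y)\big],\qquad \mathcal E_\eta^*=\inf_{h\in\mathcal H}\mathbb E_{\mu\sim\eta}\Big[\inf_{f\in\mathcal F}\mathbb E_{(X,Y)\sim\mu}\,\ell(f(h(X)),Y)\Big].$$ With independent standard normal variables $\gamma$ and Euclidean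 norms let $$G(\mathcal H(\bar{\mathbf X}))=\mathbb E_\gamma\sup_{h\in\mathcal H}\sum_{k,t,i}\gamma_{kti}\,h_k(X_{ti}),\qquad Q'=\sup_{y\in\mathbb R^{Kn}\setminus\{0\}}\frac1{\|y\|}\,\mathbb E_\gamma\sup_{f\in\mathcal F}\sum_{i=1}^n\gamma_i f(y_i),$$ where $y=(y_1,\dots,y_n)$ with $y_i\in\mathbb R^K$, and let $\|h(\mathbf X_t)\|^2=\sum_{i=1}^n\|h(X_{ti})\|^2$. Assume $Q'<\infty$ (which holds, for instance, if $f(0)=0$ for all $f\in\mathcal F$). The bounds below may take the value $+\infty$, with the convention $0\cdot\infty=0$. **Theorem.** Let $\delta>0$. (i) With probability at least $1-\delta$ in the draw of $\bar{\mathbf Z}\sim\rho_\eta^T$, every solution $\hat h$ satisfies $$\mathcal E_\eta(\hat h)-\mathcal E_\eta^*\le\frac{\sqrt{2\pi}\,L\,G(\mathcal H(\bar{\mathbf X}))}{T\sqrt n}+\sqrt{2\pi}\,Q'\sup_{h\in\mathcal H}\sqrt{\frac{\mathbb E_{(X,Y)\sim\mu_\eta}\big[\|h(X)\|^2\big]}{n}}+\sqrt{\frac{8\ln(4/\delta)}{T}}.$$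 (ii) With probability at least $1-\delta$ in the draw of $\bar{\mathbf Z}\sim\rho_\eta^T$, every solution $\hat h$ satisfies $$\mathcal E_\eta(\hat h)-\mathcal E_\eta^*\le\frac{\sqrt{2\pi}\,L\,G(\mathcal H(\bar{\mathbf X}))}{T\sqrt n}+\frac{\sqrt{2\pi}\,Q'\,\frac1T\sum_{t=1}^T\sup_{h\in\mathcal H}\|h(\mathbf X_t)\|}{n}+5\sqrt{\frac{\ln(8/\delta)}{T}}.$$ -/

import Mathlib

open MeasureTheory ProbabilityTheory

noncomputable section

/-- Expectation of an extended-real random variable: `E[φ⁺] - E[φ⁻]`. -/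
def extExpectation {Ω : Type*} [MeasurableSpace Ω] (P : Measure Ω) (φ : Ω → EReal) : EReal :=
  ((∫⁻ ω, (φ ω).toENNReal ∂P : ENNReal) : EReal) - ((∫⁻ ω, (-φ ω).toENNReal ∂P : ENNReal) : EReal)

/-- The Gaussian average `G(S) = E sup_{y ∈ S} ∑ i, γ i * y i` of a set of vectors, with independent
standard normal `γ i`. It is `⊤` if `S` is unbounded and a nonnegative real number if `S` is bounded
and nonempty. -/
def gaussianAverage {ι : Type*} [Fintype ι] (S : Set (ι → ℝ)) : EReal :=
  extExpectation (Measure.pi fun _ : ι => gaussianReal 0 1)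
    fun γ => ⨆ y ∈ S, ((∑ i, γ i * y i : ℝ) : EReal)

/-- `Q'(F) = sup_{y ≠ 0} (1 / ‖y‖) E sup_{f ∈ F} ∑ i, γ i * f (y i)`, where `y = (y 1, …, y n)`
ranges over `ℝ^{Kn}` with its Euclidean norm and each `y i` is in `ℝ^K`. -/
def qPrime {K : ℕ} (n : ℕ) (F : Set (EuclideanSpace ℝ (Fin K) → ℝ)) : EReal :=
  ⨆ y : PiLp 2 fun _ : Fin n => EuclideanSpace ℝ (Fin K), ⨆ _ : y ≠ 0,
    ((1 / ‖y‖ : ℝ) : EReal) * gaussianAverage ((fun f (i : Fin n) => f (y i)) '' F)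

section Setting

variable {X : Type*} {K T n : ℕ}

/-- The set `H(X̄) = {(h_k(X_{ti}))_{t,i,k} : h ∈ H}` of vectors in `ℝ^{KTn}`, for a multisample
`Z t i = (X_{ti}, Y_{ti})`. -/
def representationSet (H : Set (X → EuclideanSpace ℝ (Fin K))) (Z : Fin T → Fin n → X × ℝ) :
    Set (Fin T × Fin n × Fin K → ℝ) :=
  (fun h p => h (Z p.1 p.2.1).1 p.2.2) '' H

/-- The vector `h(X) = (h(X_1), …, h(X_n))` of `ℝ^{Kn}`, with the Euclidean norm, for a sample
`z i = (X_i, Y_i)`. -/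
def representedSample (h : X → EuclideanSpace ℝ (Fin K)) (z : Fin n → X × ℝ) :
    PiLp 2 fun _ : Fin n => EuclideanSpace ℝ (Fin K) :=
  WithLp.toLp 2 fun i => h (z i).1

/-- The empirical risk `(1/n) ∑ i, ℓ(f(h(X_i)), Y_i)` of `f ∘ h` on one sample. -/
def empiricalRisk (l : ℝ → ℝ → ℝ) (z : Fin n → X × ℝ) (h : X → EuclideanSpace ℝ (Fin K))
    (f : EuclideanSpace ℝ (Fin K) → ℝ) : ℝ :=
  (1 / (n : ℝ)) * ∑ i, l (f (h (z i).1)) (z i).2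

/-- The objective `(1/(nT)) ∑ t, ∑ i, ℓ(f_t(h(X_{ti})), Y_{ti})` of multitask representation
learning. -/
def multitaskRisk (l : ℝ → ℝ → ℝ) (Z : Fin T → Fin n → X × ℝ) (h : X → EuclideanSpace ℝ (Fin K))
    (f : Fin T → EuclideanSpace ℝ (Fin K) → ℝ) : ℝ :=
  (1 / ((n : ℝ) * (T : ℝ))) * ∑ t, ∑ i, l (f t (h (Z t i).1)) (Z t i).2

/-- `h` (together with some `f_1, …, f_T ∈ F`) solves the multitask representation learning problem
for the multisample `Z`. -/
def IsMTRLSolution (l : ℝ → ℝ → ℝ) (H : Set (X → EuclideanSpace ℝ (Fin K)))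
    (F : Set (EuclideanSpace ℝ (Fin K) → ℝ)) (Z : Fin T → Fin n → X × ℝ)
    (h : X → EuclideanSpace ℝ (Fin K)) : Prop :=
  h ∈ H ∧ ∃ f : Fin T → EuclideanSpace ℝ (Fin K) → ℝ, (∀ t, f t ∈ F) ∧
    ∀ h' ∈ H, ∀ f' : Fin T → EuclideanSpace ℝ (Fin K) → ℝ, (∀ t, f' t ∈ F) →
      multitaskRisk l Z h f ≤ multitaskRisk l Z h' f'

/-- `fhat h z` is, for every `h ∈ H` and every sample `z`, a minimizer over `F` of the empirical risk
of `f ∘ h` on `z`. -/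
def IsEmpiricalMinimizer (l : ℝ → ℝ → ℝ) (H : Set (X → EuclideanSpace ℝ (Fin K)))
    (F : Set (EuclideanSpace ℝ (Fin K) → ℝ))
    (fhat : (X → EuclideanSpace ℝ (Fin K)) → (Fin n → X × ℝ) → EuclideanSpace ℝ (Fin K) → ℝ) :
    Prop :=
  ∀ h ∈ H, ∀ z, fhat h z ∈ F ∧ ∀ f ∈ F, empiricalRisk l z h (fhat h z) ≤ empiricalRisk l z h f

variable [MeasurableSpace X]

/-- The mixture `μ_η(A) = E_{μ ∼ η} μ(A)`. -/
def mixture (η : Measure (ProbabilityMeasure (X × ℝ))) : Measure (X × ℝ) :=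
  η.bind fun μ => (μ : Measure (X × ℝ))

/-- The law `ρ_η(A) = E_{μ ∼ η} μ^n(A)` of an `n`-sample of a random task. -/
def sampleLaw (n : ℕ) (η : Measure (ProbabilityMeasure (X × ℝ))) : Measure (Fin n → X × ℝ) :=
  η.bind fun μ => Measure.pi fun _ : Fin n => (μ : Measure (X × ℝ))

/-- The risk `E_{μ ∼ η} E_{Z ∼ μ^n} E_{(X,Y) ∼ μ} ℓ(a(h)_Z(X), Y)`, with `a(h)_Z = fhat h Z ∘ h`. -/
def environmentRisk (l : ℝ → ℝ → ℝ) (η : Measure (ProbabilityMeasure (X × ℝ)))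
    (fhat : (X → EuclideanSpace ℝ (Fin K)) → (Fin n → X × ℝ) → EuclideanSpace ℝ (Fin K) → ℝ)
    (h : X → EuclideanSpace ℝ (Fin K)) : ℝ :=
  ∫ μ, ∫ z, ∫ p, l (fhat h z (h p.1)) p.2 ∂(μ : Measure (X × ℝ))
    ∂(Measure.pi fun _ : Fin n => (μ : Measure (X × ℝ))) ∂η

/-- The optimal risk `inf_{h ∈ H} E_{μ ∼ η} [inf_{f ∈ F} E_{(X,Y) ∼ μ} ℓ(f(h(X)), Y)]`. -/
def optimalRisk (l : ℝ → ℝ → ℝ) (η : Measure (ProbabilityMeasure (X × ℝ)))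
    (H : Set (X → EuclideanSpace ℝ (Fin K))) (F : Set (EuclideanSpace ℝ (Fin K) → ℝ)) : ℝ :=
  ⨅ h : H, ∫ μ, ⨅ f : F, ∫ p, l (f.1 (h.1 p.1)) p.2 ∂(μ : Measure (X × ℝ)) ∂η

end Setting

/-- The property `p` holds with probability at least `1 - δ`: it holds on a measurable event of
probability at least `1 - δ`. -/
def WithProbAtLeast {Ω : Type*} [MeasurableSpace Ω] (P : Measure Ω) (δ : ℝ) (p : Ω → Prop) : Prop :=
  ∃ E : Set Ω, MeasurableSet E ∧ ENNReal.ofReal (1 - δ) ≤ P E ∧ ∀ ω ∈ E, p ω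

end

/-! The excess risk splits at the minimal empirical risk `minRisk` of a representation `h` on a
sample, written m_h(z) here. Two estimates that hold without high probability frame the argument.
Symmetrization inside a single task, averaged over `η`, gives that the risk of `h` is at most E m_h
plus the expected value of 2/n times the Rademacher average of the losses (`environmentRisk_le`).
Conversely, E m_h is at most the optimal risk attainable with `h`, since the empirical minimizer
beats every fixed `f` on the sample (`integral_minRisk_le`).

It remains to compare E m_ĥ with the infimum over `h` of E m_h. The samples of the `T` tasks are
i.i.d. with law `sampleLaw n η`, and ĥ minimizes the empirical mean of m_h, so this is a uniform
deviation problem for the class of functions m_h. `measure_uniform_deviation_ge` applies McDiarmid's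
inequality once, to a single function combining the deviation from a ghost sample, the minimal
empirical mean, the empirical Rademacher average and, for (ii), an empirical mean bounding the
estimation errors. Symmetrization controls the mean of this combination, so no union bound is
needed, and log(1/δ) already suffices.

Rademacher averages become Gaussian ones by a contraction principle (`rademacher_le_integral_iSup`):
signs are replaced one coordinate at a time by a symmetric process whose increments are large enough
in L¹. A standard Gaussian form with coefficient vector w has mean absolute value √(2/π)‖w‖, hence
the factor √(π/2), and with the 2 from symmetrization √(2π). Across tasks, m_h is L/√n-Lipschitz in
the represented sample, which produces the term in G; within a task the losses are 1-Lipschitz in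
the predictions, which produces Q'‖h(X)‖. For (i) the latter is integrated with the Cauchy–Schwarz
inequality; for (ii) its supremum over `h`, truncated at 2, is estimated from the data.

Measurability of suprema comes from countable dense families in `H` and in `F`. -/

noncomputable section

/-! ### Integration over finite products -/

section Products

variable {Ω : Type*} [MeasurableSpace Ω]

lemma integrable_of_measurable_of_bound {μ : Measure Ω} [IsFiniteMeasure μ] {f : Ω → ℝ}
    (hf : Measurable f) (B : ℝ) (hB : ∀ x, |f x| ≤ B) : Integrable f μ :=
  Integrable.of_bound hf.aestronglyMeasurable B (Filter.Eventually.of_forall hB)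

lemma measurePreserving_finCons (P : Measure Ω) [IsProbabilityMeasure P] (m : ℕ) :
    MeasurePreserving (fun q : Ω × (Fin m → Ω) => (Fin.cons q.1 q.2 : Fin (m + 1) → Ω))
      (P.prod (Measure.pi fun _ : Fin m => P)) (Measure.pi fun _ : Fin (m + 1) => P) := by
  have h := (measurePreserving_piFinSuccAbove (fun _ : Fin (m + 1) => P) 0).symm
  convert h using 1
  ext q : 1
  exact (Fin.insertNth_zero' q.1 q.2).symm

lemma measurable_finCons (m : ℕ) :
    Measurable (fun q : Ω × (Fin m → Ω) => (Fin.cons q.1 q.2 : Fin (m + 1) → Ω)) := by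
  refine measurable_pi_lambda _ fun i => ?_
  refine Fin.cases ?_ (fun j => ?_) i
  · simpa using measurable_fst
  · exact (measurable_pi_apply j).comp measurable_snd

lemma integrable_comp_finCons {P : Measure Ω} [IsProbabilityMeasure P] {m : ℕ}
    {f : (Fin (m + 1) → Ω) → ℝ} (hf : Integrable f (Measure.pi fun _ => P)) :
    Integrable (fun q : Ω × (Fin m → Ω) => f (Fin.cons q.1 q.2))
      (P.prod (Measure.pi fun _ : Fin m => P)) :=
  (measurePreserving_finCons P m).integrable_comp_of_integrable hf

lemma integral_pi_succ {P : Measure Ω} [IsProbabilityMeasure P] {m : ℕ}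
    {f : (Fin (m + 1) → Ω) → ℝ} (hf : Integrable f (Measure.pi fun _ => P)) :
    ∫ Z, f Z ∂(Measure.pi fun _ : Fin (m + 1) => P) =
      ∫ Z, ∫ x, f (Fin.cons x Z) ∂P ∂(Measure.pi fun _ : Fin m => P) := by
  have hmp := measurePreserving_finCons P m
  rw [← hmp.map_eq, integral_map hmp.measurable.aemeasurable
    (by rw [hmp.map_eq]; exact hf.aestronglyMeasurable)]
  exact integral_prod_symm _ (integrable_comp_finCons hf)

end Products

/-! ### The bounded differences inequality -/

section BoundedDifferences

variable {Ω : Type*} [MeasurableSpace Ω]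

/-- Hoeffding's lemma for a function of oscillation at most `c`. -/
lemma integral_exp_le_of_oscillation {P : Measure Ω} [IsProbabilityMeasure P] {c : ℝ}
    {f : Ω → ℝ} (hf : Measurable f) (hosc : ∀ x y, |f x - f y| ≤ c) (t : ℝ) :
    ∫ x, Real.exp (t * (f x - ∫ y, f y ∂P)) ∂P ≤ Real.exp (c ^ 2 * t ^ 2 / 8) := by
  have : Nonempty Ω := nonempty_of_isProbabilityMeasure P
  obtain ⟨x₀⟩ := this
  have hc : 0 ≤ c := (abs_nonneg _).trans (hosc x₀ x₀)
  have hbdd : BddBelow (Set.range f) := by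
    refine ⟨f x₀ - c, ?_⟩
    rintro _ ⟨y, rfl⟩
    have := (abs_le.1 (hosc x₀ y)).2
    linarith
  have hmem : ∀ x, f x ∈ Set.Icc (⨅ y, f y) ((⨅ y, f y) + c) := by
    intro x
    refine ⟨ciInf_le hbdd x, ?_⟩
    have : Nonempty Ω := ⟨x₀⟩
    have : f x - c ≤ ⨅ y, f y := le_ciInf fun y => by
      have := (abs_le.1 (hosc x y)).2
      linarith
    linarith
  have h := (hasSubgaussianMGF_of_mem_Icc (μ := P) hf.aemeasurable
    (Filter.Eventually.of_forall hmem)).mgf_le t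
  refine (le_of_eq_of_le ?_ h).trans (le_of_eq ?_)
  · rfl
  · congr 1
    simp only [add_sub_cancel_left, NNReal.coe_pow, NNReal.coe_div, coe_nnnorm, Real.norm_eq_abs,
      abs_of_nonneg hc, NNReal.coe_ofNat]
    ring

/-- Induction on the number of variables: averaging out the first coordinate leaves a function `W₁`
of the others with the same mean and the same bounded differences, while, with the others fixed, `W`
minus `W₁` is handled by Hoeffding's lemma. The bound `B` serves only integrability. -/
lemma integral_exp_le_of_bounded_differences {P : Measure Ω} [IsProbabilityMeasure P] {c : ℝ}
    (t B : ℝ) : ∀ (m : ℕ) (W : (Fin m → Ω) → ℝ), Measurable W → (∀ Z, |W Z| ≤ B) →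
      (∀ Z i x y, |W (Function.update Z i x) - W (Function.update Z i y)| ≤ c) →
      ∫ Z, Real.exp (t * (W Z - ∫ Z', W Z' ∂(Measure.pi fun _ => P)))
        ∂(Measure.pi fun _ : Fin m => P) ≤ Real.exp (m * (c ^ 2 * t ^ 2 / 8))
  | 0, W, _, _, _ => by
    have h : ∀ Z, W Z = W default := fun Z => congrArg W (Subsingleton.elim _ _)
    simp [h]
  | m + 1, W, hW, hB, hc => by
    have : Nonempty Ω := nonempty_of_isProbabilityMeasure P
    obtain ⟨x₀⟩ := this
    have hB0 : 0 ≤ B := (abs_nonneg _).trans (hB fun _ => x₀)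
    set W₁ : (Fin m → Ω) → ℝ := fun Z => ∫ x, W (Fin.cons x Z) ∂P with hW₁
    have hcons : Measurable fun q : (Fin m → Ω) × Ω => W (Fin.cons q.2 q.1) :=
      hW.comp ((measurable_finCons m).comp measurable_swap)
    have hW₁_meas : Measurable W₁ :=
      (hcons.stronglyMeasurable.integral_prod_right (ν := P)).measurable
    have hcx : ∀ Z : Fin m → Ω, Measurable fun x => W (Fin.cons x Z) := fun Z =>
      hcons.comp measurable_prodMk_left
    have hint : ∀ Z : Fin m → Ω, Integrable (fun x => W (Fin.cons x Z)) P := fun Z =>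
      integrable_of_measurable_of_bound (hcx Z) B fun x => hB _
    have hW₁_bdd : ∀ Z, |W₁ Z| ≤ B := by
      intro Z
      have := norm_integral_le_of_norm_le_const (μ := P) (f := fun x => W (Fin.cons x Z)) (C := B)
        (Filter.Eventually.of_forall fun x => hB _)
      simpa using this
    have hW₁_diff : ∀ Z i x y,
        |W₁ (Function.update Z i x) - W₁ (Function.update Z i y)| ≤ c := by
      intro Z i x y
      rw [hW₁]
      simp only
      rw [← integral_sub (hint _) (hint _)]
      have := norm_integral_le_of_norm_le_const (μ := P)
        (f := fun a => W (Fin.cons a (Function.update Z i x)) -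
          W (Fin.cons a (Function.update Z i y))) (C := c)
        (Filter.Eventually.of_forall fun a => by
          rw [Fin.cons_update, Fin.cons_update]; exact hc _ _ _ _)
      simpa using this
    have hmean : ∫ Z, W Z ∂(Measure.pi fun _ : Fin (m + 1) => P) =
        ∫ Z, W₁ Z ∂(Measure.pi fun _ : Fin m => P) :=
      integral_pi_succ (integrable_of_measurable_of_bound hW B hB)
    have ih := integral_exp_le_of_bounded_differences (P := P) (c := c) t B m W₁ hW₁_meas hW₁_bdd hW₁_diff
    rw [hmean]
    set e := ∫ Z, W₁ Z ∂(Measure.pi fun _ : Fin m => P) with he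
    have hexp_bound : ∀ a b : ℝ, |a| ≤ B → |Real.exp (t * (a - b))| ≤
        Real.exp (|t| * (B + |b|)) := by
      intro a b ha
      rw [abs_of_pos (Real.exp_pos _)]
      refine Real.exp_le_exp.2 ((le_abs_self _).trans ?_)
      rw [abs_mul]
      gcongr
      exact (abs_sub _ _).trans (by linarith)
    rw [integral_pi_succ (P := P) (integrable_of_measurable_of_bound (by fun_prop) _
      fun Z => hexp_bound (W Z) e (hB Z))]
    have hstep : ∀ Z : Fin m → Ω, ∫ x, Real.exp (t * (W (Fin.cons x Z) - e)) ∂P ≤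
        Real.exp (c ^ 2 * t ^ 2 / 8) * Real.exp (t * (W₁ Z - e)) := by
      intro Z
      have h1 := integral_exp_le_of_oscillation (P := P) (hcx Z) (c := c) (fun x y => by
        have := hc (Fin.cons x₀ Z) 0 x y
        simpa only [Fin.update_cons_zero] using this) t
      calc ∫ x, Real.exp (t * (W (Fin.cons x Z) - e)) ∂P
          = ∫ x, Real.exp (t * (W (Fin.cons x Z) - W₁ Z)) * Real.exp (t * (W₁ Z - e)) ∂P := by
            congr 1; ext x; rw [← Real.exp_add]; congr 1; ring
        _ = (∫ x, Real.exp (t * (W (Fin.cons x Z) - W₁ Z)) ∂P) * Real.exp (t * (W₁ Z - e)) :=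
            integral_mul_const _ _
        _ ≤ _ := mul_le_mul_of_nonneg_right h1 (Real.exp_pos _).le
    calc ∫ Z, ∫ x, Real.exp (t * (W (Fin.cons x Z) - e)) ∂P ∂(Measure.pi fun _ : Fin m => P)
        ≤ ∫ Z, Real.exp (c ^ 2 * t ^ 2 / 8) * Real.exp (t * (W₁ Z - e))
            ∂(Measure.pi fun _ : Fin m => P) := by
          refine integral_mono_of_nonneg (Filter.Eventually.of_forall fun Z =>
            integral_nonneg fun x => (Real.exp_pos _).le) ?_ (Filter.Eventually.of_forall hstep)
          exact (integrable_of_measurable_of_bound (by fun_prop) _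
            fun Z => hexp_bound _ _ (hW₁_bdd Z)).const_mul _
      _ = Real.exp (c ^ 2 * t ^ 2 / 8) * ∫ Z, Real.exp (t * (W₁ Z - e))
            ∂(Measure.pi fun _ : Fin m => P) := integral_const_mul _ _
      _ ≤ Real.exp (c ^ 2 * t ^ 2 / 8) * Real.exp (m * (c ^ 2 * t ^ 2 / 8)) := by gcongr
      _ = _ := by rw [← Real.exp_add]; congr 1; push_cast; ring

/-- **McDiarmid's inequality**: a bounded function of `m` independent variables that changes by at
most `c` when one of them changes is, with probability at least `1 - δ`, at most
`c √(m log (1 / δ) / 2)` above its mean. -/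
theorem measure_le_integral_add_of_bounded_differences {P : Measure Ω} [IsProbabilityMeasure P]
    {m : ℕ} (hm : 0 < m) {W : (Fin m → Ω) → ℝ} (hW : Measurable W) {B : ℝ} (hB : ∀ Z, |W Z| ≤ B)
    {c : ℝ} (hc0 : 0 < c)
    (hc : ∀ Z i x y, |W (Function.update Z i x) - W (Function.update Z i y)| ≤ c)
    {δ : ℝ} (hδ : 0 < δ) {s : ℝ} (hs0 : 0 ≤ s) (hs : m * c ^ 2 * Real.log (1 / δ) ≤ 2 * s ^ 2) :
    ENNReal.ofReal (1 - δ) ≤ (Measure.pi fun _ : Fin m => P)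
      {Z | W Z ≤ ∫ Z', W Z' ∂(Measure.pi fun _ : Fin m => P) + s} := by
  set μ := Measure.pi fun _ : Fin m => P with hμ
  set e := ∫ Z', W Z' ∂μ with he
  have hms : MeasurableSet {Z | W Z ≤ e + s} := measurableSet_le hW measurable_const
  have hmr : (0 : ℝ) < m := by exact_mod_cast hm
  -- The minimizer of the Chernoff exponent -ts + mc²t²/8, whose minimum is -2s²/(mc²).
  set t : ℝ := 4 * s / (m * c ^ 2) with ht
  have ht0 : 0 ≤ t := by positivity
  have hint : Integrable (fun Z => Real.exp (t * (W Z - e))) μ := by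
    refine integrable_of_measurable_of_bound (by fun_prop) (Real.exp (t * (B + |e|))) fun Z => ?_
    rw [abs_of_pos (Real.exp_pos _)]
    have h1 := (abs_le.1 (hB Z)).2
    have h2 := neg_abs_le e
    gcongr
    linarith
  have hchern := measure_ge_le_exp_mul_mgf (μ := μ) (X := fun Z => W Z - e) s ht0 hint
  have hmgf := integral_exp_le_of_bounded_differences (P := P) t B m W hW hB hc
  have htail : μ.real {Z | W Z ≤ e + s}ᶜ ≤ δ := by
    calc μ.real {Z | W Z ≤ e + s}ᶜ ≤ μ.real {Z | s ≤ W Z - e} := by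
          refine measureReal_mono fun Z hZ => ?_
          simp only [Set.mem_compl_iff, Set.mem_ofPred_eq, not_le] at hZ ⊢
          linarith
      _ ≤ Real.exp (-t * s) * Real.exp (m * (c ^ 2 * t ^ 2 / 8)) :=
          hchern.trans (mul_le_mul_of_nonneg_left hmgf (Real.exp_pos _).le)
      _ = Real.exp (-(2 * s ^ 2 / (m * c ^ 2))) := by
          rw [← Real.exp_add]; congr 1; rw [ht]; field_simp; ring
      _ ≤ Real.exp (-Real.log (1 / δ)) := by
          refine Real.exp_le_exp.2 (neg_le_neg ?_)
          rw [le_div_iff₀ (by positivity)]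
          linarith
      _ = δ := by rw [one_div, Real.log_inv, neg_neg, Real.exp_log hδ]
  rw [measureReal_compl hms, probReal_univ] at htail
  rw [← ofReal_measureReal]
  exact ENNReal.ofReal_le_ofReal (by linarith)

end BoundedDifferences

/-! ### Suprema of bounded families -/

section Suprema

variable {D : Type*}

lemma bddAbove_range_of_abs_le {a : D → ℝ} {B : ℝ} (ha : ∀ d, |a d| ≤ B) :
    BddAbove (Set.range a) :=
  ⟨B, by rintro _ ⟨d, rfl⟩; exact (abs_le.1 (ha d)).2⟩

lemma bddBelow_range_of_abs_le {a : D → ℝ} {B : ℝ} (ha : ∀ d, |a d| ≤ B) :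
    BddBelow (Set.range a) :=
  ⟨-B, by rintro _ ⟨d, rfl⟩; exact (abs_le.1 (ha d)).1⟩

lemma abs_iSup_le [Nonempty D] {a : D → ℝ} {B : ℝ} (ha : ∀ d, |a d| ≤ B) : |⨆ d, a d| ≤ B := by
  obtain ⟨d⟩ := ‹Nonempty D›
  have : Nonempty D := ⟨d⟩
  exact abs_le.2 ⟨(abs_le.1 (ha d)).1.trans (le_ciSup (bddAbove_range_of_abs_le ha) d),
    ciSup_le fun d => (abs_le.1 (ha d)).2⟩

lemma abs_iInf_le [Nonempty D] {a : D → ℝ} {B : ℝ} (ha : ∀ d, |a d| ≤ B) : |⨅ d, a d| ≤ B := by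
  obtain ⟨d⟩ := ‹Nonempty D›
  have : Nonempty D := ⟨d⟩
  exact abs_le.2 ⟨le_ciInf fun d => (abs_le.1 (ha d)).1,
    (ciInf_le (bddBelow_range_of_abs_le ha) d).trans (abs_le.1 (ha d)).2⟩

lemma abs_iSup_sub_iSup_le [Nonempty D] {a b : D → ℝ} {B c : ℝ} (ha : ∀ d, |a d| ≤ B)
    (hb : ∀ d, |b d| ≤ B) (hab : ∀ d, |a d - b d| ≤ c) : |(⨆ d, a d) - ⨆ d, b d| ≤ c := by
  have key : ∀ a b : D → ℝ, (∀ d, |b d| ≤ B) → (∀ d, |a d - b d| ≤ c) →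
      (⨆ d, a d) ≤ (⨆ d, b d) + c := fun a b hb hab => ciSup_le fun d => by
    have h1 := (abs_le.1 (hab d)).2
    have h2 := le_ciSup (bddAbove_range_of_abs_le hb) d
    linarith
  have h1 := key a b hb hab
  have h2 := key b a ha fun d => abs_sub_comm (a d) (b d) ▸ hab d
  exact abs_le.2 ⟨by linarith, by linarith⟩

lemma abs_iInf_sub_iInf_le [Nonempty D] {a b : D → ℝ} {B c : ℝ} (ha : ∀ d, |a d| ≤ B)
    (hb : ∀ d, |b d| ≤ B) (hab : ∀ d, |a d - b d| ≤ c) : |(⨅ d, a d) - ⨅ d, b d| ≤ c := by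
  have key : ∀ a b : D → ℝ, (∀ d, |a d| ≤ B) → (∀ d, |a d - b d| ≤ c) →
      (⨅ d, a d) - c ≤ ⨅ d, b d := fun a b ha hab => le_ciInf fun d => by
    have h1 := (abs_le.1 (hab d)).2
    have h2 := ciInf_le (bddBelow_range_of_abs_le ha) d
    linarith
  have h1 := key a b ha hab
  have h2 := key b a hb fun d => abs_sub_comm (a d) (b d) ▸ hab d
  exact abs_le.2 ⟨by linarith, by linarith⟩

lemma abs_iSup_le_sum {I : Type*} [Fintype I] [Nonempty I] (f : I → ℝ) :
    |⨆ i, f i| ≤ ∑ i, |f i| :=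
  abs_iSup_le fun i => Finset.single_le_sum (f := fun i => |f i|) (fun _ _ => abs_nonneg _)
    (Finset.mem_univ i)

lemma integrable_iSup {I Ω : Type*} [Fintype I] [Nonempty I] [MeasurableSpace Ω] {μ : Measure Ω}
    {f : I → Ω → ℝ} (hfm : ∀ i, Measurable (f i)) (hf : ∀ i, Integrable (f i) μ) :
    Integrable (fun ω => ⨆ i, f i ω) μ :=
  (integrable_finsetSum Finset.univ fun i _ => (hf i).abs).mono'
    (Measurable.iSup hfm).aestronglyMeasurable
    (Filter.Eventually.of_forall fun _ => abs_iSup_le_sum _)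

end Suprema

/-! ### Rademacher averages -/

section Rademacher

/-- The sign `±1` encoded by a Boolean. -/
def boolSign (b : Bool) : ℝ := if b then 1 else -1

@[simp] lemma boolSign_true : boolSign true = 1 := rfl

@[simp] lemma boolSign_false : boolSign false = -1 := rfl

@[simp] lemma abs_boolSign (b : Bool) : |boolSign b| = 1 := by cases b <;> simp

/-- The Rademacher average `E sup_d ∑ i, ε i * a d i` of a family of vectors. -/
def rademacherAverage {D : Type*} {m : ℕ} (a : D → Fin m → ℝ) : ℝ :=
  (1 / 2 ^ m) * ∑ ε : Fin m → Bool, ⨆ d, ∑ i, boolSign (ε i) * a d i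

lemma sum_bool_succ {m : ℕ} (φ : (Fin (m + 1) → Bool) → ℝ) :
    ∑ ε, φ ε = ∑ b, ∑ ε : Fin m → Bool, φ (Fin.cons b ε) := by
  rw [← Fintype.sum_prod_type']
  exact (Fintype.sum_equiv (Fin.consEquiv fun _ => Bool) _ _ fun _ => rfl).symm

lemma abs_sum_boolSign_mul_le {m : ℕ} (ε : Fin m → Bool) (a : Fin m → ℝ) :
    |∑ i, boolSign (ε i) * a i| ≤ ∑ i, |a i| :=
  (Finset.abs_sum_le_sum_abs _ _).trans (by simp [abs_mul])

lemma abs_sum_boolSign_mul_le_of_le {m : ℕ} (ε : Fin m → Bool) {a : Fin m → ℝ} {B : ℝ}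
    (ha : ∀ i, |a i| ≤ B) : |∑ i, boolSign (ε i) * a i| ≤ m * B :=
  (abs_sum_boolSign_mul_le ε a).trans
    ((Finset.sum_le_sum fun i _ => ha i).trans (by simp))

variable {I Γ : Type*} [Finite I] [Nonempty I] [MeasurableSpace Γ] {ν : Measure Γ}
  [IsProbabilityMeasure ν] {σ : Γ → Γ}

/-- With `i` and `j` attaining the two suprema, the left side is half of B i + B j + ψ i - ψ j, and
the ψ-difference is at most the mean of |u i - u j|. Pointwise, B i + B j + |u i - u j| is at most
sup (B + u) + sup (B - u): the sign of u i - u j decides which index serves which supremum. By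
oddness under `σ` both suprema have the same integral. -/
lemma half_iSup_add_iSup_le_integral (hσ : MeasurePreserving σ ν ν) {u : I → Γ → ℝ}
    (hum : ∀ i, Measurable (u i)) (hu : ∀ i, Integrable (u i) ν) (hodd : ∀ i x, u i (σ x) = -u i x)
    {ψ : I → ℝ} (hψ : ∀ i j, |ψ i - ψ j| ≤ ∫ x, |u i x - u j x| ∂ν) (B : I → ℝ) :
    1 / 2 * ((⨆ i, (B i + ψ i)) + ⨆ i, (B i - ψ i)) ≤ ∫ x, ⨆ i, (B i + u i x) ∂ν := by
  have := Fintype.ofFinite I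
  obtain ⟨i, hi⟩ := exists_eq_ciSup_of_finite (f := fun i => B i + ψ i)
  obtain ⟨j, hj⟩ := exists_eq_ciSup_of_finite (f := fun i => B i - ψ i)
  rw [← hi, ← hj]
  have hplus : Integrable (fun x => ⨆ i, (B i + u i x)) ν :=
    integrable_iSup (fun i => (hum i).const_add _) fun i => (integrable_const _).add (hu i)
  have hminus : Integrable (fun x => ⨆ i, (B i - u i x)) ν :=
    integrable_iSup (fun i => (hum i).const_sub _) fun i => (integrable_const _).sub (hu i)
  have hsymm : ∫ x, ⨆ i, (B i - u i x) ∂ν = ∫ x, ⨆ i, (B i + u i x) ∂ν := by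
    have hm : Measurable fun x => ⨆ i, (B i + u i x) :=
      Measurable.iSup fun i => (hum i).const_add _
    conv_rhs => rw [← hσ.map_eq, integral_map hσ.measurable.aemeasurable
      hm.aestronglyMeasurable]
    simp only [hodd, sub_eq_add_neg]
  have hpt : ∀ x, B i + B j + |u i x - u j x| ≤ (⨆ i, (B i + u i x)) + ⨆ i, (B i - u i x) := by
    intro x
    have h1 := fun k => le_ciSup (Set.finite_range fun i => B i + u i x).bddAbove k
    have h2 := fun k => le_ciSup (Set.finite_range fun i => B i - u i x).bddAbove k
    rcases abs_cases (u i x - u j x) with h | h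
    · have := h1 i; have := h2 j; linarith
    · have := h1 j; have := h2 i; linarith
  have habs : Integrable (fun x => |u i x - u j x|) ν := ((hu i).sub (hu j)).abs
  have hle : ∫ x, (B i + B j + |u i x - u j x|) ∂ν ≤
      ∫ x, ((⨆ i, (B i + u i x)) + ⨆ i, (B i - u i x)) ∂ν :=
    integral_mono ((integrable_const _).add habs) (hplus.add hminus) hpt
  rw [integral_add (integrable_const _) habs, integral_add hplus hminus, hsymm,
    integral_const, probReal_univ, one_smul] at hle
  have h3 := (le_abs_self _).trans (hψ i j)
  linarith

/-- A Rademacher average is dominated coordinate by coordinate by the expected supremum of a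
symmetric process with larger increments. -/
lemma rademacher_le_integral_iSup (hσ : MeasurePreserving σ ν ν) :
    ∀ (m : ℕ) (A : I → ℝ) (ψ : I → Fin m → ℝ) (u : I → Fin m → Γ → ℝ),
      (∀ i t, Measurable (u i t)) → (∀ i t, Integrable (u i t) ν) →
      (∀ i t x, u i t (σ x) = -u i t x) →
      (∀ i j t, |ψ i t - ψ j t| ≤ ∫ x, |u i t x - u j t x| ∂ν) →
      (1 / 2 ^ m) * ∑ ε : Fin m → Bool, ⨆ i, (A i + ∑ t, boolSign (ε t) * ψ i t) ≤
        ∫ γ, ⨆ i, (A i + ∑ t, u i t (γ t)) ∂(Measure.pi fun _ : Fin m => ν)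
  | 0, A, ψ, u, _, _, _, _ => by simp
  | m + 1, A, ψ, u, hum, hu, hodd, hψ => by
    have := Fintype.ofFinite I
    have hint : ∀ (m : ℕ) (A : I → ℝ) (u : I → Fin m → Γ → ℝ), (∀ i t, Measurable (u i t)) →
        (∀ i t, Integrable (u i t) ν) →
        Integrable (fun γ : Fin m → Γ => ⨆ i, (A i + ∑ t, u i t (γ t)))
          (Measure.pi fun _ => ν) := by
      intro m A u hum hu
      refine integrable_iSup (fun i => ?_) fun i => ?_
      · exact (Finset.measurable_fun_sum _ fun t _ =>
          (hum i t).comp (measurable_pi_apply t)).const_add _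
      · refine (integrable_const _).add (integrable_finsetSum _ fun t _ => ?_)
        exact (measurePreserving_eval (fun _ : Fin m => ν) t).integrable_comp_of_integrable (hu i t)
    -- The free offset `A` makes the induction work: with the first sign fixed, its term is absorbed
    -- into the offset.
    have hIH : ∀ b, (1 / 2 ^ m) * ∑ ε : Fin m → Bool,
        ⨆ i, ((A i + boolSign b * ψ i 0) + ∑ t, boolSign (ε t) * ψ i t.succ) ≤
        ∫ γ, ⨆ i, ((A i + boolSign b * ψ i 0) + ∑ t, u i t.succ (γ t))
          ∂(Measure.pi fun _ : Fin m => ν) := fun b =>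
      rademacher_le_integral_iSup hσ m _ _ (fun i t => u i t.succ) (fun i t => hum i _)
        (fun i t => hu i _) (fun i t => hodd i _) fun i j t => hψ i j _
    have hsum : (1 / 2 ^ (m + 1)) * ∑ ε : Fin (m + 1) → Bool,
          ⨆ i, (A i + ∑ t, boolSign (ε t) * ψ i t) =
        1 / 2 * ∑ b, (1 / 2 ^ m) * ∑ ε : Fin m → Bool,
          ⨆ i, ((A i + boolSign b * ψ i 0) + ∑ t, boolSign (ε t) * ψ i t.succ) := by
      rw [sum_bool_succ, ← Finset.mul_sum, ← mul_assoc]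
      congr 1
      · rw [pow_succ]; ring
      · simp only [Fin.sum_univ_succ, Fin.cons_zero, Fin.cons_succ, add_assoc]
    rw [hsum, integral_pi_succ (hint _ A u hum hu)]
    refine (mul_le_mul_of_nonneg_left (Finset.sum_le_sum fun b _ => hIH b) (by norm_num)).trans ?_
    rw [Fintype.sum_bool, ← integral_add
      (hint m (fun i => A i + boolSign true * ψ i 0) (fun i t => u i t.succ) (fun i t => hum i _)
        fun i t => hu i _)
      (hint m (fun i => A i + boolSign false * ψ i 0) (fun i t => u i t.succ) (fun i t => hum i _)
        fun i t => hu i _), ← integral_const_mul]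
    refine integral_mono (((hint m _ _ (fun i t => hum i t.succ) fun i t => hu i _).add
      (hint m _ _ (fun i t => hum i t.succ) fun i t => hu i _)).const_mul _)
      (integrable_comp_finCons (hint _ A u hum hu)).integral_prod_right fun γ => ?_
    -- The remaining coordinates are already replaced by `u`; for fixed `γ` they join the offset,
    -- and only the first sign is left to exchange.
    have h := half_iSup_add_iSup_le_integral hσ (fun i => hum i 0) (fun i => hu i 0)
      (fun i x => hodd i 0 x) (fun i j => hψ i j 0) fun i => A i + ∑ t, u i t.succ (γ t)
    refine le_of_eq_of_le ?_ (h.trans_eq ?_)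
    · simp only [boolSign_true, boolSign_false]
      congr 3 <;> ext i <;> ring
    · simp only [Fin.sum_univ_succ, Fin.cons_zero, Fin.cons_succ]
      congr 1; ext x; congr 1; ext i; ring

end Rademacher

/-! ### Absolute moments of Gaussian linear forms -/

section GaussianMoments

lemma integral_abs_gaussianReal : ∫ x, |x| ∂(gaussianReal 0 1) = √(2 / Real.pi) := by
  rw [integral_gaussianReal_eq_integral_smul one_ne_zero]
  have h1 : ∀ x : ℝ, gaussianPDFReal 0 1 x • |x| =
      (fun y => (√(2 * Real.pi))⁻¹ * (y * Real.exp (-(1 / 2) * y ^ 2))) |x| := by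
    intro x
    simp only [gaussianPDFReal, NNReal.coe_one, mul_one, sub_zero, sq_abs, smul_eq_mul]
    rw [show -x ^ 2 / 2 = -(1 / 2) * x ^ 2 by ring]
    ring
  simp_rw [h1]
  rw [integral_comp_abs (f := fun y => (√(2 * Real.pi))⁻¹ * (y * Real.exp (-(1 / 2) * y ^ 2))),
    integral_const_mul]
  have h2 := integral_rpow_mul_exp_neg_mul_rpow (p := 2) (q := 1) (b := 1 / 2) two_pos
    (by norm_num) (by norm_num)
  simp only [Real.rpow_one, Real.rpow_two] at h2
  rw [h2]
  norm_num
  have hs : √2 * √2 = 2 := Real.mul_self_sqrt zero_le_two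
  field_simp
  linarith

lemma measurable_sum_mul {κ : Type*} [Fintype κ] (w : κ → ℝ) :
    Measurable fun γ : κ → ℝ => ∑ k, γ k * w k := by fun_prop

lemma map_sum_mul_pi_gaussianReal {κ : Type*} [Fintype κ] (w : κ → ℝ) :
    (Measure.pi fun _ : κ => gaussianReal 0 1).map (fun γ => ∑ k, γ k * w k) =
      gaussianReal 0 (∑ k, w k ^ 2).toNNReal := by
  set v : EuclideanSpace ℝ κ := WithLp.toLp 2 w with hv
  have h := IsGaussian.map_eq_gaussianReal (μ := stdGaussian (EuclideanSpace ℝ κ)) (innerSL ℝ v)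
  rw [integral_strongDual_stdGaussian, variance_dual_stdGaussian, innerSL_apply_norm,
    EuclideanSpace.real_norm_sq_eq, ← map_pi_eq_stdGaussian,
    Measure.map_map (by fun_prop) (by fun_prop)] at h
  convert h using 2
  ext γ
  simp [hv, PiLp.inner_apply]

lemma integrable_sum_mul_pi_gaussianReal {κ : Type*} [Fintype κ] (w : κ → ℝ) :
    Integrable (fun γ => ∑ k, γ k * w k) (Measure.pi fun _ : κ => gaussianReal 0 1) := by
  refine integrable_finsetSum _ fun k _ => Integrable.mul_const ?_ _
  exact (measurePreserving_eval (fun _ : κ => gaussianReal 0 1) k).integrable_comp_of_integrable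
    (g := fun x => x) (memLp_one_iff_integrable.1 (memLp_id_gaussianReal 1))

/-- The linear form is a centred Gaussian of standard deviation ‖w‖. This is the source of the
contraction constant: after multiplication by √(π/2), L¹ increments are exactly Euclidean distances.
-/
lemma integral_abs_sum_mul_pi_gaussianReal {κ : Type*} [Fintype κ] (w : κ → ℝ) :
    ∫ γ, |∑ k, γ k * w k| ∂(Measure.pi fun _ : κ => gaussianReal 0 1) =
      √(2 / Real.pi) * √(∑ k, w k ^ 2) := by
  have hs : 0 ≤ ∑ k, w k ^ 2 := Finset.sum_nonneg fun _ _ => sq_nonneg _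
  have hm : gaussianReal 0 (∑ k, w k ^ 2).toNNReal =
      (gaussianReal 0 1).map (fun x => √(∑ k, w k ^ 2) * x) := by
    rw [gaussianReal_map_const_mul]
    congr 1
    · simp
    · ext; simp [Real.sq_sqrt, hs]
  have h1 := integral_map (μ := Measure.pi fun _ : κ => gaussianReal 0 1)
    (measurable_sum_mul w).aemeasurable (f := fun x : ℝ => |x|)
    continuous_abs.aestronglyMeasurable
  rw [← h1, map_sum_mul_pi_gaussianReal, hm, integral_map (by fun_prop)
    continuous_abs.aestronglyMeasurable]
  simp only [abs_mul, abs_of_nonneg (Real.sqrt_nonneg _)]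
  rw [integral_const_mul, integral_abs_gaussianReal, mul_comm]

lemma sqrt_pi_div_two_mul_sqrt : √(Real.pi / 2) * √(2 / Real.pi) = 1 := by
  rw [← Real.sqrt_mul (by positivity)]
  have := Real.pi_pos
  rw [Real.sqrt_eq_one]
  field_simp

lemma measurePreserving_neg_pi_gaussianReal {κ : Type*} [Fintype κ] :
    MeasurePreserving (fun γ : κ → ℝ => fun k => -γ k)
      (Measure.pi fun _ : κ => gaussianReal 0 1) (Measure.pi fun _ : κ => gaussianReal 0 1) :=
  measurePreserving_pi _ _ fun _ => ⟨measurable_neg, by simpa using gaussianReal_map_neg (μ := 0)⟩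

lemma measurePreserving_curry {ι κ : Type*} [Fintype ι] [Fintype κ] (μ : Measure ℝ)
    [IsProbabilityMeasure μ] :
    MeasurePreserving (MeasurableEquiv.curry ι κ ℝ) (Measure.pi fun _ : ι × κ => μ)
      (Measure.pi fun _ : ι => Measure.pi fun _ : κ => μ) := by
  refine ⟨(MeasurableEquiv.curry ι κ ℝ).measurable, ?_⟩
  have h := Measure.infinitePi_map_curry (fun (_ : ι) (_ : κ) => μ)
  simpa only [Measure.infinitePi_eq_pi] using h

end GaussianMoments

/-! ### Gaussian averages -/

section GaussianAverages

lemma extExpectation_mono {Ω : Type*} [MeasurableSpace Ω] {P : Measure Ω} {φ ψ : Ω → EReal}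
    (h : ∀ ω, φ ω ≤ ψ ω) : extExpectation P φ ≤ extExpectation P ψ :=
  EReal.sub_le_sub
    (EReal.coe_ennreal_le_coe_ennreal_iff.2 (lintegral_mono fun ω =>
      EReal.toENNReal_le_toENNReal (h ω)))
    (EReal.coe_ennreal_le_coe_ennreal_iff.2 (lintegral_mono fun ω =>
      EReal.toENNReal_le_toENNReal (EReal.neg_le_neg_iff.2 (h ω))))

lemma extExpectation_coe {Ω : Type*} [MeasurableSpace Ω] {P : Measure Ω} {φ : Ω → ℝ}
    (h : Integrable φ P) : extExpectation P (fun ω => (φ ω : EReal)) = (∫ ω, φ ω ∂P : ℝ) := by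
  have h1 : ∫⁻ ω, ENNReal.ofReal (φ ω) ∂P ≠ ⊤ := h.lintegral_lt_top.ne
  have h2 : ∫⁻ ω, ENNReal.ofReal (-φ ω) ∂P ≠ ⊤ := h.neg.lintegral_lt_top.ne
  unfold extExpectation
  simp only [← EReal.coe_neg, EReal.toENNReal_of_ne_top (EReal.coe_ne_top _), EReal.toReal_coe]
  rw [integral_eq_lintegral_pos_part_sub_lintegral_neg_part h, EReal.coe_sub,
    EReal.coe_ennreal_toReal h1, EReal.coe_ennreal_toReal h2]

/-- Restricting to finitely many vectors gives an integrable supremum, whereas the supremum over `S`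
may be infinite or nonmeasurable; monotonicity of `extExpectation` requires neither finiteness nor
measurability. -/
lemma integral_iSup_le_gaussianAverage {ι I : Type*} [Fintype ι] [Finite I] [Nonempty I]
    {S : Set (ι → ℝ)} (v : I → ι → ℝ) (hv : ∀ i, v i ∈ S) :
    ((∫ γ, ⨆ i, ∑ k, γ k * v i k ∂(Measure.pi fun _ : ι => gaussianReal 0 1) : ℝ) : EReal) ≤
      gaussianAverage S := by
  have := Fintype.ofFinite I
  rw [← extExpectation_coe (integrable_iSup (fun i => measurable_sum_mul (v i))
    fun i => integrable_sum_mul_pi_gaussianReal (v i))]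
  refine extExpectation_mono fun γ => ?_
  obtain ⟨i, hi⟩ := exists_eq_ciSup_of_finite (f := fun i => ∑ k, γ k * v i k)
  rw [← hi]
  exact le_iSup₂_of_le (v i) (hv i) le_rfl

/-- A single vector of `S` already contributes a centred Gaussian, of mean zero. -/
lemma gaussianAverage_nonneg {ι : Type*} [Fintype ι] {S : Set (ι → ℝ)} (hS : S.Nonempty) :
    0 ≤ gaussianAverage S := by
  obtain ⟨y, hy⟩ := hS
  refine le_trans (le_of_eq ?_) (integral_iSup_le_gaussianAverage (I := Unit) (fun _ => y)
    fun _ => hy)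
  have h : ∫ γ, ∑ k, γ k * y k ∂(Measure.pi fun _ : ι => gaussianReal 0 1) = 0 := by
    rw [← integral_map (μ := Measure.pi fun _ : ι => gaussianReal 0 1) (f := fun x : ℝ => x)
      (measurable_sum_mul y).aemeasurable (by fun_prop), map_sum_mul_pi_gaussianReal,
      integral_id_gaussianReal]
  simp [h]

/-- There are only 2^m sign vectors, so one near-maximizer for each of them yields a finite
subfamily that nearly attains the average. The contraction argument needs finiteness, for attained
suprema and integrability. -/
lemma exists_rademacherAverage_comp_ge {D : Type*} [Nonempty D] {m : ℕ} {ψ : D → Fin m → ℝ}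
    {r : ℝ} (hr : 0 < r) :
    ∃ i : (Fin m → Bool) → D, rademacherAverage ψ ≤ rademacherAverage (fun ε => ψ (i ε)) + r := by
  have hlt : ∀ ε : Fin m → Bool, ∃ d, (⨆ d, ∑ t, boolSign (ε t) * ψ d t) - r <
      ∑ t, boolSign (ε t) * ψ d t := fun ε => exists_lt_of_lt_ciSup (by linarith)
  choose i hi using hlt
  refine ⟨i, ?_⟩
  have hcard : (1 / 2 ^ m : ℝ) * ∑ _ε : Fin m → Bool, r = r := by simp
  unfold rademacherAverage
  conv_rhs => rw [← hcard]
  rw [← mul_add, ← Finset.sum_add_distrib]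
  refine mul_le_mul_of_nonneg_left (Finset.sum_le_sum fun ε _ => ?_) (by positivity)
  have h1 := le_ciSup (Set.finite_range fun ε' => ∑ t, boolSign (ε t) * ψ (i ε') t).bddAbove ε
  have h2 := hi ε
  linarith

lemma coe_rademacherAverage_le_of_finite {D : Type*} [Nonempty D] {m : ℕ} {ψ : D → Fin m → ℝ}
    {x : EReal}
    (h : ∀ i : (Fin m → Bool) → D, ((rademacherAverage (fun ε => ψ (i ε)) : ℝ) : EReal) ≤ x) :
    ((rademacherAverage ψ : ℝ) : EReal) ≤ x := by
  refine EReal.le_of_forall_lt_iff_le.1 fun z hz => EReal.coe_le_coe_iff.2 ?_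
  refine le_of_forall_pos_le_add fun r hr => ?_
  obtain ⟨i, hi⟩ := exists_rademacherAverage_comp_ge (ψ := ψ) hr
  have := EReal.coe_lt_coe_iff.1 ((h i).trans_lt hz)
  linarith

/-- Vector contraction: a Rademacher average is at most `√(π / 2)` times the Gaussian average of a
family of vectors with larger Euclidean increments. -/
lemma rademacherAverage_le_gaussianAverage {D κ : Type*} [Nonempty D] [Fintype κ] {m : ℕ}
    {ψ : D → Fin m → ℝ} (v : D → Fin m × κ → ℝ)
    (hv : ∀ d d' t, |ψ d t - ψ d' t| ≤ √(∑ k, (v d (t, k) - v d' (t, k)) ^ 2)) :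
    ((rademacherAverage ψ : ℝ) : EReal) ≤
      ((√(Real.pi / 2) : ℝ) : EReal) * gaussianAverage (Set.range v) := by
  refine coe_rademacherAverage_le_of_finite fun i => ?_
  set C := √(Real.pi / 2) with hC
  have hC0 : 0 ≤ C := Real.sqrt_nonneg _
  -- The comparison process attaches an independent Gaussian vector indexed by `κ` to each
  -- coordinate `t`; with the factor `C` its L¹ increments equal the Euclidean increments of `v`.
  -- Uncurrying then merges these vectors into one indexed by pairs.
  have h1 := rademacher_le_integral_iSup (measurePreserving_neg_pi_gaussianReal (κ := κ)) m
    (fun _ => 0) (fun ε t => ψ (i ε) t) (fun ε t γ => C * ∑ k, γ k * v (i ε) (t, k))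
    (fun ε t => (measurable_sum_mul _).const_mul _)
    (fun ε t => (integrable_sum_mul_pi_gaussianReal _).const_mul _)
    (fun ε t γ => by simp [Finset.sum_neg_distrib])
    (fun ε ε' t => by
      have : ∀ γ : κ → ℝ, |C * ∑ k, γ k * v (i ε) (t, k) - C * ∑ k, γ k * v (i ε') (t, k)| =
          C * |∑ k, γ k * (v (i ε) (t, k) - v (i ε') (t, k))| := by
        intro γ
        rw [← mul_sub, abs_mul, abs_of_nonneg hC0, ← Finset.sum_sub_distrib]
        simp only [mul_sub]
      simp only [this]
      rw [integral_const_mul, integral_abs_sum_mul_pi_gaussianReal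
        fun k => v (i ε) (t, k) - v (i ε') (t, k), ← mul_assoc,
        sqrt_pi_div_two_mul_sqrt, one_mul]
      exact hv _ _ _)
  have hmp := measurePreserving_curry (ι := Fin m) (κ := κ) (gaussianReal 0 1)
  rw [← hmp.integral_comp'] at h1
  simp only [zero_add] at h1
  have h2 : ∀ γ : Fin m × κ → ℝ, (⨆ ε, ∑ t, C * ∑ k, γ (t, k) * v (i ε) (t, k)) =
      C * ⨆ ε, ∑ p, γ p * v (i ε) p := by
    intro γ
    rw [Real.mul_iSup_of_nonneg hC0]
    simp only [Fintype.sum_prod_type, Finset.mul_sum]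
  have h3 : rademacherAverage (fun ε => ψ (i ε)) ≤
      C * ∫ γ, ⨆ ε, ∑ p, γ p * v (i ε) p ∂(Measure.pi fun _ => gaussianReal 0 1) := by
    rw [← integral_const_mul]
    refine h1.trans_eq (integral_congr_ae (Filter.Eventually.of_forall fun γ => ?_))
    exact h2 γ
  refine (EReal.coe_le_coe_iff.2 h3).trans ?_
  rw [EReal.coe_mul]
  exact mul_le_mul_of_nonneg_left
    (integral_iSup_le_gaussianAverage (fun ε => v (i ε)) fun ε => ⟨i ε, rfl⟩)
    (EReal.coe_nonneg.2 hC0)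

/-- Scalar contraction. -/
lemma rademacherAverage_le_gaussianAverage_scalar {D : Type*} [Nonempty D] {m : ℕ}
    {ψ : D → Fin m → ℝ} (v : D → Fin m → ℝ)
    (hv : ∀ d d' t, |ψ d t - ψ d' t| ≤ |v d t - v d' t|) :
    ((rademacherAverage ψ : ℝ) : EReal) ≤
      ((√(Real.pi / 2) : ℝ) : EReal) * gaussianAverage (Set.range v) := by
  refine coe_rademacherAverage_le_of_finite fun i => ?_
  set C := √(Real.pi / 2) with hC
  have hC0 : 0 ≤ C := Real.sqrt_nonneg _
  have hid : Integrable (fun x : ℝ => x) (gaussianReal 0 1) :=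
    memLp_one_iff_integrable.1 (memLp_id_gaussianReal 1)
  have h1 := rademacher_le_integral_iSup (ν := gaussianReal 0 1) (σ := fun x => -x)
    ⟨measurable_neg, by simpa using gaussianReal_map_neg (μ := 0)⟩ m
    (fun _ => 0) (fun ε t => ψ (i ε) t) (fun ε t x => C * (x * v (i ε) t))
    (fun ε t => by fun_prop) (fun ε t => (hid.mul_const _).const_mul _)
    (fun ε t γ => by simp)
    (fun ε ε' t => by
      have : ∀ x : ℝ, |C * (x * v (i ε) t) - C * (x * v (i ε') t)| =
          C * (|x| * |v (i ε) t - v (i ε') t|) := by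
        intro x
        rw [← mul_sub, abs_mul, abs_of_nonneg hC0, ← mul_sub, abs_mul]
      simp only [this]
      rw [integral_const_mul, integral_mul_const, integral_abs_gaussianReal, ← mul_assoc,
        sqrt_pi_div_two_mul_sqrt, one_mul]
      exact hv _ _ _)
  simp only [zero_add] at h1
  have h2 : ∀ γ : Fin m → ℝ, (⨆ ε, ∑ t, C * (γ t * v (i ε) t)) =
      C * ⨆ ε, ∑ p, γ p * v (i ε) p := by
    intro γ
    rw [Real.mul_iSup_of_nonneg hC0]
    simp only [Finset.mul_sum]
  have h3 : rademacherAverage (fun ε => ψ (i ε)) ≤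
      C * ∫ γ, ⨆ ε, ∑ p, γ p * v (i ε) p ∂(Measure.pi fun _ => gaussianReal 0 1) := by
    rw [← integral_const_mul]
    refine h1.trans_eq (integral_congr_ae (Filter.Eventually.of_forall fun γ => ?_))
    exact h2 γ
  refine (EReal.coe_le_coe_iff.2 h3).trans ?_
  rw [EReal.coe_mul]
  exact mul_le_mul_of_nonneg_left
    (integral_iSup_le_gaussianAverage (fun ε => v (i ε)) fun ε => ⟨i ε, rfl⟩)
    (EReal.coe_nonneg.2 hC0)

end GaussianAverages

/-! ### Symmetrization -/

section Symmetrization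

variable {Ω : Type*} [MeasurableSpace Ω]

/-- Exchange of the coordinates of two samples selected by `ε`. -/
lemma measurePreserving_swapAt (P : Measure Ω) [IsProbabilityMeasure P] {m : ℕ}
    (ε : Fin m → Bool) :
    MeasurePreserving (fun q : (Fin m → Ω) × (Fin m → Ω) =>
        ((fun i => if ε i then q.1 i else q.2 i : Fin m → Ω),
          (fun i => if ε i then q.2 i else q.1 i : Fin m → Ω)))
      ((Measure.pi fun _ => P).prod (Measure.pi fun _ => P))
      ((Measure.pi fun _ => P).prod (Measure.pi fun _ => P)) := by
  have hA := measurePreserving_arrowProdEquivProdArrow Ω Ω (Fin m) (fun _ => P) (fun _ => P)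
  have hS := measurePreserving_pi (fun _ : Fin m => P.prod P) (fun _ : Fin m => P.prod P)
    (f := fun i q => if ε i then q else q.swap) fun i => by
      by_cases h : ε i
      · simp only [h, if_true]; exact MeasurePreserving.id (P.prod P)
      · simpa [h] using Measure.measurePreserving_swap (μ := P) (ν := P)
  have h := (hA.comp hS).comp hA.symm
  convert h using 1
  ext q : 1
  refine Prod.ext ?_ ?_ <;> ext i <;>
    by_cases hi : ε i <;>
    simp [MeasurableEquiv.arrowProdEquivProdArrow, Equiv.arrowProdEquivProdArrow, hi]

lemma abs_sum_sub_le_of_mem_Icc {m : ℕ} {a b : Fin m → ℝ} (ha : ∀ i, a i ∈ Set.Icc (0 : ℝ) 1)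
    (hb : ∀ i, b i ∈ Set.Icc (0 : ℝ) 1) : |∑ i, (a i - b i)| ≤ m := by
  refine (Finset.abs_sum_le_sum_abs _ _).trans ((Finset.sum_le_sum (g := fun _ => (1 : ℝ))
    fun i _ => ?_).trans (by simp))
  exact abs_le.2 ⟨by linarith [(ha i).1, (hb i).2], by linarith [(ha i).2, (hb i).1]⟩

lemma abs_le_one_of_mem_Icc {a : ℝ} (ha : a ∈ Set.Icc (0 : ℝ) 1) : |a| ≤ 1 :=
  abs_le.2 ⟨by linarith [ha.1], ha.2⟩

lemma measurable_rademacherAverage {D : Type*} [Countable D] {m : ℕ} {a : D → Fin m → Ω → ℝ}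
    (ha : ∀ d i, Measurable (a d i)) : Measurable fun ω => rademacherAverage fun d i => a d i ω := by
  unfold rademacherAverage
  exact (Finset.measurable_fun_sum _ fun ε _ => Measurable.iSup fun d =>
    Finset.measurable_fun_sum _ fun i _ => (ha d i).const_mul _).const_mul _

lemma abs_rademacherAverage_le {D : Type*} [Nonempty D] {m : ℕ} {a : D → Fin m → ℝ} {B : ℝ}
    (ha : ∀ d i, |a d i| ≤ B) : |rademacherAverage a| ≤ m * B := by
  have h : ∀ ε : Fin m → Bool, |⨆ d, ∑ i, boolSign (ε i) * a d i| ≤ m * B := fun ε =>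
    abs_iSup_le fun d => abs_sum_boolSign_mul_le_of_le ε (ha d)
  unfold rademacherAverage
  rw [abs_mul, abs_of_nonneg (by positivity)]
  refine (mul_le_mul_of_nonneg_left ((Finset.abs_sum_le_sum_abs _ _).trans
    (Finset.sum_le_sum fun ε _ => h ε)) (by positivity)).trans (le_of_eq ?_)
  simp

lemma abs_rademacherAverage_sub_le {D : Type*} [Nonempty D] {m : ℕ} {a b : D → Fin m → ℝ} {B c : ℝ}
    (ha : ∀ d i, |a d i| ≤ B) (hb : ∀ d i, |b d i| ≤ B) (hab : ∀ d, ∑ i, |a d i - b d i| ≤ c) :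
    |rademacherAverage a - rademacherAverage b| ≤ c := by
  have h : ∀ ε : Fin m → Bool, |(⨆ d, ∑ i, boolSign (ε i) * a d i) -
      ⨆ d, ∑ i, boolSign (ε i) * b d i| ≤ c := fun ε =>
    abs_iSup_sub_iSup_le (fun d => abs_sum_boolSign_mul_le_of_le ε (ha d))
      (fun d => abs_sum_boolSign_mul_le_of_le ε (hb d)) fun d => by
        rw [← Finset.sum_sub_distrib]
        simp only [← mul_sub]
        exact (abs_sum_boolSign_mul_le ε fun i => a d i - b d i).trans (hab d)
  unfold rademacherAverage
  rw [← mul_sub, abs_mul, abs_of_nonneg (by positivity : (0 : ℝ) ≤ 1 / 2 ^ m),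
    ← Finset.sum_sub_distrib]
  refine (mul_le_mul_of_nonneg_left ((Finset.abs_sum_le_sum_abs _ _).trans
    (Finset.sum_le_sum fun ε _ => h ε)) (by positivity)).trans (le_of_eq ?_)
  simp

/-- Flipping every sign permutes the sign vectors. It identifies the two halves produced by
symmetrization. -/
lemma rademacherAverage_neg {D : Type*} {m : ℕ} (a : D → Fin m → ℝ) :
    rademacherAverage (fun d i => -a d i) = rademacherAverage a := by
  unfold rademacherAverage
  congr 1
  refine Fintype.sum_equiv (Equiv.piCongrRight fun _ => Equiv.boolNot) _ _ fun ε => ?_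
  congr 1; ext d; congr 1; ext i
  cases h : ε i <;> simp [h]

lemma measurable_iSup_sum_sub {D : Type*} [Countable D] {g : D → Ω → ℝ}
    (hg : ∀ d, Measurable (g d)) (m : ℕ) :
    Measurable fun q : (Fin m → Ω) × (Fin m → Ω) => ⨆ d, ∑ i, (g d (q.1 i) - g d (q.2 i)) :=
  Measurable.iSup fun d => Finset.measurable_fun_sum _ fun i _ =>
    ((hg d).comp ((measurable_pi_apply i).comp measurable_fst)).sub
      ((hg d).comp ((measurable_pi_apply i).comp measurable_snd))

/-- **Symmetrization**: the expected maximal deviation between two samples is at most twice the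
expected Rademacher average. -/
theorem integral_iSup_sum_sub_le_rademacherAverage {D : Type*} [Countable D] [Nonempty D]
    (P : Measure Ω) [IsProbabilityMeasure P] {g : D → Ω → ℝ} (hg : ∀ d, Measurable (g d))
    (hg01 : ∀ d ω, g d ω ∈ Set.Icc (0 : ℝ) 1) (m : ℕ) :
    ∫ Z, ∫ Z', ⨆ d, ∑ i, (g d (Z' i) - g d (Z i)) ∂(Measure.pi fun _ : Fin m => P)
        ∂(Measure.pi fun _ : Fin m => P) ≤
      2 * ∫ Z, rademacherAverage (fun d i => g d (Z i)) ∂(Measure.pi fun _ : Fin m => P) := by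
  set μ := Measure.pi fun _ : Fin m => P with hμ
  set Φ : (Fin m → Ω) × (Fin m → Ω) → ℝ := fun q => ⨆ d, ∑ i, (g d (q.1 i) - g d (q.2 i)) with hΦ
  have hΦm : Measurable Φ := measurable_iSup_sum_sub hg m
  have hΦint : Integrable Φ (μ.prod μ) := integrable_of_measurable_of_bound hΦm m fun q =>
    abs_iSup_le fun d => abs_sum_sub_le_of_mem_Icc (fun i => hg01 d _) fun i => hg01 d _
  set R : (Fin m → Bool) → (Fin m → Ω) → ℝ := fun ε Z =>
    ⨆ d, ∑ i, boolSign (ε i) * g d (Z i) with hR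
  set R' : (Fin m → Bool) → (Fin m → Ω) → ℝ := fun ε Z =>
    ⨆ d, ∑ i, boolSign (ε i) * -g d (Z i) with hR'
  have hsb : ∀ (ε : Fin m → Bool) d (Z : Fin m → Ω), |∑ i, boolSign (ε i) * g d (Z i)| ≤ m * 1 :=
    fun ε d Z => abs_sum_boolSign_mul_le_of_le ε fun i => abs_le_one_of_mem_Icc (hg01 d _)
  have hsb' : ∀ (ε : Fin m → Bool) d (Z : Fin m → Ω),
      |∑ i, boolSign (ε i) * -g d (Z i)| ≤ m * 1 :=
    fun ε d Z => abs_sum_boolSign_mul_le_of_le ε fun i => by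
      rw [abs_neg]; exact abs_le_one_of_mem_Icc (hg01 d _)
  have hRint : ∀ ε, Integrable (R ε) μ := fun ε => integrable_of_measurable_of_bound
    (Measurable.iSup fun d => Finset.measurable_fun_sum _ fun i _ =>
      ((hg d).comp (measurable_pi_apply i)).const_mul _) (m * 1) fun Z =>
    abs_iSup_le fun d => hsb ε d Z
  have hRint' : ∀ ε, Integrable (R' ε) μ := fun ε => integrable_of_measurable_of_bound
    (Measurable.iSup fun d => Finset.measurable_fun_sum _ fun i _ =>
      ((hg d).comp (measurable_pi_apply i)).neg.const_mul _) (m * 1) fun Z =>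
    abs_iSup_le fun d => hsb' ε d Z
  have hfub : ∫ Z, ∫ Z', ⨆ d, ∑ i, (g d (Z' i) - g d (Z i)) ∂μ ∂μ = ∫ q, Φ q ∂(μ.prod μ) :=
    (integral_prod_symm Φ hΦint).symm
  -- Exchanging the two samples where `ε` is false preserves the law and multiplies the i-th
  -- difference by its sign; the supremum of a sum then splits into one supremum per sample.
  have hε : ∀ ε : Fin m → Bool, ∫ q, Φ q ∂(μ.prod μ) ≤ ∫ Z, R ε Z ∂μ + ∫ Z, R' ε Z ∂μ := by
    intro ε
    have hmp := measurePreserving_swapAt P ε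
    have h1 : ∫ q, Φ q ∂(μ.prod μ) = ∫ q, Φ ((fun i => if ε i then q.1 i else q.2 i),
        (fun i => if ε i then q.2 i else q.1 i)) ∂(μ.prod μ) := by
      conv_lhs => rw [← hmp.map_eq, integral_map hmp.measurable.aemeasurable
        hΦm.aestronglyMeasurable]
    have hfst : ∫ q, R ε q.1 ∂(μ.prod μ) = ∫ Z, R ε Z ∂μ := by
      simpa using integral_fun_fst (μ := μ) (ν := μ) (R ε)
    have hsnd : ∫ q, R' ε q.2 ∂(μ.prod μ) = ∫ Z, R' ε Z ∂μ := by
      simpa using integral_fun_snd (μ := μ) (ν := μ) (R' ε)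
    rw [h1, ← hfst, ← hsnd, ← integral_add ((hRint ε).comp_fst μ) ((hRint' ε).comp_snd μ)]
    refine integral_mono (hmp.integrable_comp_of_integrable hΦint)
      (((hRint ε).comp_fst μ).add ((hRint' ε).comp_snd μ)) fun q => ciSup_le fun d => ?_
    have e1 := le_ciSup (bddAbove_range_of_abs_le fun d => hsb ε d q.1) d
    have e2 := le_ciSup (bddAbove_range_of_abs_le fun d => hsb' ε d q.2) d
    refine le_trans (le_of_eq ?_) (add_le_add e1 e2)
    rw [← Finset.sum_add_distrib]
    refine Finset.sum_congr rfl fun i _ => ?_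
    by_cases h : ε i <;> simp [h, sub_eq_add_neg, add_comm]
  have hrad : ∫ Z, rademacherAverage (fun d i => g d (Z i)) ∂μ =
      (1 / 2 ^ m) * ∑ ε, ∫ Z, R ε Z ∂μ := by
    unfold rademacherAverage
    rw [integral_const_mul, integral_finsetSum _ fun ε _ => hRint ε]
  have hrad' : ∫ Z, rademacherAverage (fun d i => g d (Z i)) ∂μ =
      (1 / 2 ^ m) * ∑ ε, ∫ Z, R' ε Z ∂μ := by
    simp_rw [← rademacherAverage_neg fun d i => g d _]
    unfold rademacherAverage
    rw [integral_const_mul, integral_finsetSum _ fun ε _ => hRint' ε]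
  have hsum : ∑ _ε : Fin m → Bool, ∫ q, Φ q ∂(μ.prod μ) ≤
      ∑ ε, (∫ Z, R ε Z ∂μ + ∫ Z, R' ε Z ∂μ) := Finset.sum_le_sum fun ε _ => hε ε
  have hcard : (1 / 2 ^ m : ℝ) * ∑ _ε : Fin m → Bool, ∫ q, Φ q ∂(μ.prod μ) =
      ∫ q, Φ q ∂(μ.prod μ) := by simp
  rw [hfub, two_mul]
  conv_rhs => enter [1]; rw [hrad]
  conv_rhs => enter [2]; rw [hrad']
  rw [← mul_add, ← Finset.sum_add_distrib, ← hcard]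
  exact mul_le_mul_of_nonneg_left hsum (by positivity)

end Symmetrization

/-! ### The law of a sample of a random task -/

section Environment

variable {Ω : Type*} [MeasurableSpace Ω]

/-- Boxes form a generating π-system, and the mass of a box is a finite product of evaluations of
`μ`. -/
lemma measurable_pi_probabilityMeasure (n : ℕ) :
    Measurable fun μ : ProbabilityMeasure Ω => Measure.pi fun _ : Fin n => (μ : Measure Ω) := by
  refine Measurable.measure_of_isPiSystem_of_isProbabilityMeasure generateFrom_pi.symm
    isPiSystem_pi ?_
  rintro _ ⟨s, hs, rfl⟩
  simp only [Measure.pi_pi]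
  exact Finset.measurable_fun_prod _ fun i _ =>
    (Measure.measurable_coe (hs i trivial)).comp measurable_subtype_coe

/-- The kernel `μ ↦ μ^n`. -/
def sampleKernel (Ω : Type*) [MeasurableSpace Ω] (n : ℕ) :
    Kernel (ProbabilityMeasure Ω) (Fin n → Ω) where
  toFun μ := Measure.pi fun _ : Fin n => (μ : Measure Ω)
  measurable' := measurable_pi_probabilityMeasure n

/-- The kernel `μ ↦ μ`. -/
def taskKernel (Ω : Type*) [MeasurableSpace Ω] : Kernel (ProbabilityMeasure Ω) Ω where
  toFun μ := (μ : Measure Ω)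
  measurable' := measurable_subtype_coe

instance (n : ℕ) : IsMarkovKernel (sampleKernel Ω n) :=
  ⟨fun μ => inferInstanceAs (IsProbabilityMeasure (Measure.pi fun _ : Fin n => (μ : Measure Ω)))⟩

instance : IsMarkovKernel (taskKernel Ω) :=
  ⟨fun μ => inferInstanceAs (IsProbabilityMeasure (μ : Measure Ω))⟩

lemma measurable_integral_pi {n : ℕ} {f : (Fin n → Ω) → ℝ} (hf : Measurable f) :
    Measurable fun μ : ProbabilityMeasure Ω =>
      ∫ z, f z ∂(Measure.pi fun _ : Fin n => (μ : Measure Ω)) :=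
  (hf.stronglyMeasurable.integral_kernel (κ := sampleKernel Ω n)).measurable

lemma measurable_integral_probabilityMeasure {f : Ω → ℝ} (hf : Measurable f) :
    Measurable fun μ : ProbabilityMeasure Ω => ∫ z, f z ∂(μ : Measure Ω) :=
  (hf.stronglyMeasurable.integral_kernel (κ := taskKernel Ω)).measurable

lemma abs_integral_le_of_abs_le {P : Measure Ω} [IsProbabilityMeasure P] {f : Ω → ℝ} {B : ℝ}
    (hB : ∀ x, |f x| ≤ B) : |∫ x, f x ∂P| ≤ B := by
  simpa using norm_integral_le_of_norm_le_const (μ := P) (f := f) (C := B)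
    (Filter.Eventually.of_forall hB)

lemma integrable_integral_pi {n : ℕ} {f : (Fin n → Ω) → ℝ} (hf : Measurable f) {B : ℝ}
    (hB : ∀ z, |f z| ≤ B) (η : Measure (ProbabilityMeasure Ω)) [IsProbabilityMeasure η] :
    Integrable (fun μ : ProbabilityMeasure Ω =>
      ∫ z, f z ∂(Measure.pi fun _ : Fin n => (μ : Measure Ω))) η :=
  integrable_of_measurable_of_bound (measurable_integral_pi hf) B fun _ =>
    abs_integral_le_of_abs_le hB

lemma integral_comp_measure {α : Type*} [MeasurableSpace α] {κ : Kernel α Ω} [IsMarkovKernel κ]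
    {η : Measure α} [IsProbabilityMeasure η] {f : Ω → ℝ} (hf : Measurable f) {B : ℝ}
    (hB : ∀ z, |f z| ≤ B) : ∫ z, f z ∂(η.bind κ) = ∫ a, ∫ z, f z ∂(κ a) ∂η := by
  rw [← Measure.snd_compProd, Measure.snd, integral_map measurable_snd.aemeasurable
    hf.aestronglyMeasurable, Measure.integral_compProd (f := fun p => f p.2)
    (integrable_of_measurable_of_bound (hf.comp measurable_snd) B fun _ => hB _)]

variable {X : Type*} [MeasurableSpace X]

instance (n : ℕ) (η : Measure (ProbabilityMeasure (X × ℝ))) [IsProbabilityMeasure η] :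
    IsProbabilityMeasure (sampleLaw n η) :=
  inferInstanceAs (IsProbabilityMeasure (η.bind (sampleKernel (X × ℝ) n)))

lemma integral_sampleLaw (n : ℕ) (η : Measure (ProbabilityMeasure (X × ℝ)))
    [IsProbabilityMeasure η] {f : (Fin n → X × ℝ) → ℝ} (hf : Measurable f) {B : ℝ}
    (hB : ∀ z, |f z| ≤ B) :
    ∫ z, f z ∂(sampleLaw n η) =
      ∫ μ, ∫ z, f z ∂(Measure.pi fun _ : Fin n => (μ : Measure (X × ℝ))) ∂η :=
  integral_comp_measure (κ := sampleKernel (X × ℝ) n) hf hB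

lemma lintegral_sampleLaw (n : ℕ) (η : Measure (ProbabilityMeasure (X × ℝ)))
    {f : (Fin n → X × ℝ) → ENNReal} (hf : Measurable f) :
    ∫⁻ z, f z ∂(sampleLaw n η) =
      ∫⁻ μ, ∫⁻ z, f z ∂(Measure.pi fun _ : Fin n => (μ : Measure (X × ℝ))) ∂η :=
  Measure.lintegral_bind (measurable_pi_probabilityMeasure n).aemeasurable hf.aemeasurable

lemma lintegral_mixture (η : Measure (ProbabilityMeasure (X × ℝ)))
    {f : X × ℝ → ENNReal} (hf : Measurable f) :
    ∫⁻ p, f p ∂(mixture η) = ∫⁻ μ, ∫⁻ p, f p ∂(μ : Measure (X × ℝ)) ∂η :=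
  Measure.lintegral_bind measurable_subtype_coe.aemeasurable hf.aemeasurable

lemma lintegral_sum_sampleLaw (n : ℕ) (η : Measure (ProbabilityMeasure (X × ℝ)))
    {f : X × ℝ → ENNReal} (hf : Measurable f) :
    ∫⁻ z, ∑ i, f (z i) ∂(sampleLaw n η) = n * ∫⁻ p, f p ∂(mixture η) := by
  have hm : ∀ i : Fin n, Measurable fun z : Fin n → X × ℝ => f (z i) := fun i =>
    hf.comp (measurable_pi_apply i)
  rw [lintegral_sampleLaw n η (Finset.measurable_fun_sum _ fun i _ => hm i), lintegral_mixture η hf,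
    ← lintegral_const_mul' _ _ (ENNReal.natCast_ne_top n)]
  refine lintegral_congr fun μ => ?_
  rw [lintegral_finsetSum _ fun i _ => hm i]
  have : ∀ i : Fin n, ∫⁻ z, f (z i) ∂(Measure.pi fun _ : Fin n => (μ : Measure (X × ℝ))) =
      ∫⁻ p, f p ∂(μ : Measure (X × ℝ)) := fun i =>
    (measurePreserving_eval (fun _ : Fin n => (μ : Measure (X × ℝ))) i).lintegral_comp hf
  simp [this]

end Environment

/-! ### Separability of the class of specialized predictors -/

section Separability

/-- The continuous functions on a Euclidean space form a second countable space, so every subset is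
separable; convergence there implies pointwise convergence. Hence no separability assumption on `F`
is needed. -/
lemma exists_seq_pointwise_dense {K : ℕ} {F : Set (EuclideanSpace ℝ (Fin K) → ℝ)}
    (hF : ∀ f ∈ F, Continuous f) (hne : F.Nonempty) :
    ∃ u : ℕ → EuclideanSpace ℝ (Fin K) → ℝ, (∀ k, u k ∈ F) ∧
      ∀ f ∈ F, ∃ φ : ℕ → ℕ, ∀ x,
        Filter.Tendsto (fun j => u (φ j) x) Filter.atTop (nhds (f x)) := by
  set S : Set C(EuclideanSpace ℝ (Fin K), ℝ) := {f | ⇑f ∈ F} with hS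
  obtain ⟨f₀, hf₀⟩ := hne
  have : Nonempty S := ⟨⟨⟨f₀, hF f₀ hf₀⟩, hf₀⟩⟩
  have : SecondCountableTopology S := TopologicalSpace.Subtype.secondCountableTopology S
  refine ⟨fun k => (TopologicalSpace.denseSeq S k).1, fun k => (TopologicalSpace.denseSeq S k).2,
    fun f hf => ?_⟩
  have hmem := TopologicalSpace.denseRange_denseSeq S ⟨⟨f, hF f hf⟩, hf⟩
  obtain ⟨x, hx, hlim⟩ := mem_closure_iff_seq_limit.1 hmem
  choose φ hφ using hx
  refine ⟨φ, fun y => ?_⟩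
  have hc : Continuous fun g : S => g.1 y :=
    (ContinuousEvalConst.continuous_eval_const y).comp continuous_subtype_val
  have := (hc.tendsto _).comp hlim
  simp only [Function.comp_def, ← hφ] at this
  exact this

end Separability

/-! ### Risks -/

section Risks

variable {X : Type*} {K T n : ℕ} {l : ℝ → ℝ → ℝ} {H : Set (X → EuclideanSpace ℝ (Fin K))}
  {F : Set (EuclideanSpace ℝ (Fin K) → ℝ)} {L : NNReal}
  {fhat : (X → EuclideanSpace ℝ (Fin K)) → (Fin n → X × ℝ) → EuclideanSpace ℝ (Fin K) → ℝ}

lemma mean_mem_Icc {m : ℕ} {a : Fin m → ℝ} (ha : ∀ i, a i ∈ Set.Icc (0 : ℝ) 1) :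
    (1 / (m : ℝ)) * ∑ i, a i ∈ Set.Icc (0 : ℝ) 1 := by
  refine ⟨mul_nonneg (by positivity) (Finset.sum_nonneg fun i _ => (ha i).1), ?_⟩
  have h : ∑ i, a i ≤ m := (Finset.sum_le_sum fun i _ => (ha i).2).trans (by simp)
  rw [one_div_mul_eq_div]
  exact div_le_one_of_le₀ h (Nat.cast_nonneg m)

lemma empiricalRisk_mem_Icc (hl : ∀ u y, l u y ∈ Set.Icc (0 : ℝ) 1) (z : Fin n → X × ℝ)
    (h : X → EuclideanSpace ℝ (Fin K)) (f : EuclideanSpace ℝ (Fin K) → ℝ) :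
    empiricalRisk l z h f ∈ Set.Icc (0 : ℝ) 1 :=
  mean_mem_Icc fun _ => hl _ _

/-- The minimal empirical risk over `F` of the representation `h` on the sample `z`. -/
def minRisk (l : ℝ → ℝ → ℝ)
    (fhat : (X → EuclideanSpace ℝ (Fin K)) → (Fin n → X × ℝ) → EuclideanSpace ℝ (Fin K) → ℝ)
    (h : X → EuclideanSpace ℝ (Fin K)) (z : Fin n → X × ℝ) : ℝ :=
  empiricalRisk l z h (fhat h z)

/-- The average over the tasks of the minimal empirical risks. -/
def meanMinRisk (l : ℝ → ℝ → ℝ)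
    (fhat : (X → EuclideanSpace ℝ (Fin K)) → (Fin n → X × ℝ) → EuclideanSpace ℝ (Fin K) → ℝ)
    (h : X → EuclideanSpace ℝ (Fin K)) (Z : Fin T → Fin n → X × ℝ) : ℝ :=
  (1 / (T : ℝ)) * ∑ t, minRisk l fhat h (Z t)

lemma minRisk_mem_Icc (hl : ∀ u y, l u y ∈ Set.Icc (0 : ℝ) 1)
    (h : X → EuclideanSpace ℝ (Fin K)) (z : Fin n → X × ℝ) :
    minRisk l fhat h z ∈ Set.Icc (0 : ℝ) 1 :=
  empiricalRisk_mem_Icc hl _ _ _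

lemma multitaskRisk_eq (Z : Fin T → Fin n → X × ℝ) (h : X → EuclideanSpace ℝ (Fin K))
    (f : Fin T → EuclideanSpace ℝ (Fin K) → ℝ) :
    multitaskRisk l Z h f = (1 / (T : ℝ)) * ∑ t, empiricalRisk l (Z t) h (f t) := by
  unfold multitaskRisk empiricalRisk
  rw [← Finset.mul_sum, ← mul_assoc, one_div_mul_one_div, mul_comm (T : ℝ)]

/-- For a fixed representation the multitask objective separates over the tasks, so minimizing over
the predictors replaces each task's term by its minimal empirical risk. -/
lemma meanMinRisk_le_of_isMTRLSolution (hfhat : IsEmpiricalMinimizer l H F fhat)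
    {Z : Fin T → Fin n → X × ℝ} {hhat : X → EuclideanSpace ℝ (Fin K)}
    (hs : IsMTRLSolution l H F Z hhat) {h : X → EuclideanSpace ℝ (Fin K)} (hh : h ∈ H) :
    meanMinRisk l fhat hhat Z ≤ meanMinRisk l fhat h Z := by
  obtain ⟨hH, f, hf, hmin⟩ := hs
  have h1 := hmin h hh (fun t => fhat h (Z t)) fun t => (hfhat h hh (Z t)).1
  rw [multitaskRisk_eq, multitaskRisk_eq] at h1
  refine le_trans ?_ h1
  exact mul_le_mul_of_nonneg_left (Finset.sum_le_sum fun t _ =>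
    (hfhat hhat hH (Z t)).2 _ (hf t)) (by positivity)

lemma abs_loss_sub_le (hl_lip : ∀ y, LipschitzWith 1 fun u => l u y) (u v y : ℝ) :
    |l u y - l v y| ≤ |u - v| := by
  have := (hl_lip y).dist_le_mul u v
  simpa [Real.dist_eq] using this

lemma abs_sub_le_of_lipschitzWith {f : EuclideanSpace ℝ (Fin K) → ℝ} (hf : LipschitzWith L f)
    (x y : EuclideanSpace ℝ (Fin K)) : |f x - f y| ≤ L * ‖x - y‖ := by
  simpa [Real.dist_eq, dist_eq_norm] using hf.dist_le_mul x y

lemma empiricalRisk_le_add (hl_lip : ∀ y, LipschitzWith 1 fun u => l u y)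
    {f : EuclideanSpace ℝ (Fin K) → ℝ} (hf : LipschitzWith L f) (z : Fin n → X × ℝ)
    (h h' : X → EuclideanSpace ℝ (Fin K)) :
    empiricalRisk l z h f ≤
      empiricalRisk l z h' f + (L / n) * ∑ i, ‖h (z i).1 - h' (z i).1‖ := by
  have hn0 : (0 : ℝ) ≤ 1 / n := by positivity
  have : ∑ i, l (f (h (z i).1)) (z i).2 ≤
      ∑ i, l (f (h' (z i).1)) (z i).2 + L * ∑ i, ‖h (z i).1 - h' (z i).1‖ := by
    rw [Finset.mul_sum, ← Finset.sum_add_distrib]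
    refine Finset.sum_le_sum fun i _ => ?_
    have h1 := (le_abs_self _).trans (abs_loss_sub_le hl_lip (f (h (z i).1)) (f (h' (z i).1))
      (z i).2)
    have h2 := abs_sub_le_of_lipschitzWith hf (h (z i).1) (h' (z i).1)
    linarith
  refine (mul_le_mul_of_nonneg_left this hn0).trans (le_of_eq ?_)
  unfold empiricalRisk
  ring

/-- The minimizer for `h'` is a competitor in the problem for `h`. -/
lemma minRisk_le_add (hl_lip : ∀ y, LipschitzWith 1 fun u => l u y)
    (hF_lip : ∀ f ∈ F, LipschitzWith L f) (hfhat : IsEmpiricalMinimizer l H F fhat)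
    {h h' : X → EuclideanSpace ℝ (Fin K)} (hh : h ∈ H) (hh' : h' ∈ H) (z : Fin n → X × ℝ) :
    minRisk l fhat h z ≤ minRisk l fhat h' z + (L / n) * ∑ i, ‖h (z i).1 - h' (z i).1‖ :=
  ((hfhat h hh z).2 _ (hfhat h' hh' z).1).trans
    (empiricalRisk_le_add hl_lip (hF_lip _ (hfhat h' hh' z).1) z h h')

lemma abs_minRisk_sub_le (hl_lip : ∀ y, LipschitzWith 1 fun u => l u y)
    (hF_lip : ∀ f ∈ F, LipschitzWith L f) (hfhat : IsEmpiricalMinimizer l H F fhat)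
    {h h' : X → EuclideanSpace ℝ (Fin K)} (hh : h ∈ H) (hh' : h' ∈ H) (z : Fin n → X × ℝ) :
    |minRisk l fhat h z - minRisk l fhat h' z| ≤
      (L / n) * ∑ i, ‖h (z i).1 - h' (z i).1‖ := by
  have h1 := minRisk_le_add hl_lip hF_lip hfhat hh hh' z
  have h2 := minRisk_le_add hl_lip hF_lip hfhat hh' hh z
  simp only [norm_sub_rev (h' _)] at h2
  exact abs_le.2 ⟨by linarith, by linarith⟩

/-- The Cauchy–Schwarz inequality turns the ℓ¹ sum over the sample into a Euclidean norm at the cost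
√n, so the Lipschitz constant L/n becomes L/√n. This is the form that vector contraction requires.
-/
lemma abs_minRisk_sub_le_sqrt (hn : 0 < n) (hl_lip : ∀ y, LipschitzWith 1 fun u => l u y)
    (hF_lip : ∀ f ∈ F, LipschitzWith L f) (hfhat : IsEmpiricalMinimizer l H F fhat)
    {h h' : X → EuclideanSpace ℝ (Fin K)} (hh : h ∈ H) (hh' : h' ∈ H) (z : Fin n → X × ℝ) :
    |minRisk l fhat h z - minRisk l fhat h' z| ≤ (L / √n) *
      √(∑ p : Fin n × Fin K, (h (z p.1).1 p.2 - h' (z p.1).1 p.2) ^ 2) := by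
  refine (abs_minRisk_sub_le hl_lip hF_lip hfhat hh hh' z).trans ?_
  have hsq : ∑ p : Fin n × Fin K, (h (z p.1).1 p.2 - h' (z p.1).1 p.2) ^ 2 =
      ∑ i, ‖h (z i).1 - h' (z i).1‖ ^ 2 := by
    rw [Fintype.sum_prod_type]
    simp [EuclideanSpace.real_norm_sq_eq]
  have hcs : ∑ i, ‖h (z i).1 - h' (z i).1‖ ≤ √n * √(∑ i, ‖h (z i).1 - h' (z i).1‖ ^ 2) := by
    rw [← Real.sqrt_mul (Nat.cast_nonneg n)]
    refine Real.le_sqrt_of_sq_le ?_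
    simpa using sq_sum_le_card_mul_sum_sq (s := Finset.univ)
      (f := fun i => ‖h (z i).1 - h' (z i).1‖)
  have hn' : (0 : ℝ) < n := by exact_mod_cast hn
  have hs : 0 < √(n : ℝ) := Real.sqrt_pos.2 hn'
  rw [hsq]
  refine (mul_le_mul_of_nonneg_left hcs (by positivity)).trans (le_of_eq ?_)
  have : (n : ℝ) = √n * √n := (Real.mul_self_sqrt hn'.le).symm
  rw [← mul_assoc]
  congr 1
  rw [div_mul_eq_mul_div, div_eq_div_iff hn'.ne' hs.ne', mul_assoc, ← this]

/-- For the topology of pointwise convergence on `H`: only the values at the points of `z` matter.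
Closed inequalities thus pass from a dense sequence to all of `H`. -/
lemma continuous_minRisk (hl_lip : ∀ y, LipschitzWith 1 fun u => l u y)
    (hF_lip : ∀ f ∈ F, LipschitzWith L f) (hfhat : IsEmpiricalMinimizer l H F fhat)
    (z : Fin n → X × ℝ) : Continuous fun h : H => minRisk l fhat h.1 z := by
  refine continuous_iff_continuousAt.2 fun h => ?_
  refine tendsto_iff_dist_tendsto_zero.2 ?_
  have hc : Continuous fun h' : H => (L / n : ℝ) * ∑ i, ‖h'.1 (z i).1 - h.1 (z i).1‖ := by
    refine continuous_const.mul (continuous_finsetSum _ fun i _ => ?_)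
    exact (((continuous_apply (z i).1).comp continuous_subtype_val).sub continuous_const).norm
  have ht := hc.tendsto h
  simp only [sub_self, norm_zero, Finset.sum_const_zero, mul_zero] at ht
  exact squeeze_zero (fun _ => dist_nonneg) (fun h' => by
    rw [Real.dist_eq]
    exact abs_minRisk_sub_le hl_lip hF_lip hfhat h'.2 h.2 z) ht

lemma continuous_meanMinRisk (hl_lip : ∀ y, LipschitzWith 1 fun u => l u y)
    (hF_lip : ∀ f ∈ F, LipschitzWith L f) (hfhat : IsEmpiricalMinimizer l H F fhat)
    (Z : Fin T → Fin n → X × ℝ) : Continuous fun h : H => meanMinRisk l fhat h.1 Z :=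
  continuous_const.mul (continuous_finsetSum _ fun t _ =>
    continuous_minRisk hl_lip hF_lip hfhat (Z t))

/-- The Rademacher average of the losses of a sequence of specialized predictors. -/
def lossRademacher (l : ℝ → ℝ → ℝ) (u : ℕ → EuclideanSpace ℝ (Fin K) → ℝ)
    (h : X → EuclideanSpace ℝ (Fin K)) (z : Fin n → X × ℝ) : ℝ :=
  rademacherAverage fun k i => l (u k (h (z i).1)) (z i).2

lemma abs_lossRademacher_le (hl : ∀ u y, l u y ∈ Set.Icc (0 : ℝ) 1)
    (u : ℕ → EuclideanSpace ℝ (Fin K) → ℝ) (h : X → EuclideanSpace ℝ (Fin K))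
    (z : Fin n → X × ℝ) : |lossRademacher l u h z| ≤ n := by
  simpa [lossRademacher] using abs_rademacherAverage_le (B := 1)
    (a := fun k i => l (u k (h (z i).1)) (z i).2) fun k i => abs_le_one_of_mem_Icc (hl _ _)

variable [MeasurableSpace X]

lemma measurable_loss_comp (hl_meas : Measurable fun p : ℝ × ℝ => l p.1 p.2)
    {f : EuclideanSpace ℝ (Fin K) → ℝ} (hf : Continuous f) {h : X → EuclideanSpace ℝ (Fin K)}
    (hh : Measurable h) : Measurable fun p : X × ℝ => l (f (h p.1)) p.2 :=
  hl_meas.comp ((hf.measurable.comp (hh.comp measurable_fst)).prodMk measurable_snd)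

/-- The predictor is a Carathéodory function, continuous in the feature vector and measurable in the
sample, hence jointly measurable. -/
lemma measurable_loss_fhat (hl_meas : Measurable fun p : ℝ × ℝ => l p.1 p.2)
    (hF_lip : ∀ f ∈ F, LipschitzWith L f) (hfhat : IsEmpiricalMinimizer l H F fhat)
    {h : X → EuclideanSpace ℝ (Fin K)} (hh : h ∈ H) (hh_meas : Measurable h)
    (hfhat_meas : ∀ v, Measurable fun z => fhat h z v) :
    Measurable fun q : (Fin n → X × ℝ) × (X × ℝ) => l (fhat h q.1 (h q.2.1)) q.2.2 := by
  have hj : Measurable (Function.uncurry fun v z => fhat h z v) :=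
    measurable_uncurry_of_continuous_of_measurable
      (fun z => (hF_lip _ (hfhat h hh z).1).continuous) hfhat_meas
  refine hl_meas.comp (Measurable.prodMk ?_ (measurable_snd.comp measurable_snd))
  exact hj.comp ((hh_meas.comp (measurable_fst.comp measurable_snd)).prodMk measurable_fst)

lemma measurable_minRisk (hl_meas : Measurable fun p : ℝ × ℝ => l p.1 p.2)
    (hF_lip : ∀ f ∈ F, LipschitzWith L f) (hfhat : IsEmpiricalMinimizer l H F fhat)
    {h : X → EuclideanSpace ℝ (Fin K)} (hh : h ∈ H) (hh_meas : Measurable h)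
    (hfhat_meas : ∀ v, Measurable fun z => fhat h z v) : Measurable (minRisk l fhat h) := by
  unfold minRisk empiricalRisk
  refine (Finset.measurable_fun_sum _ fun i _ => ?_).const_mul _
  exact (measurable_loss_fhat hl_meas hF_lip hfhat hh hh_meas hfhat_meas).comp
    (measurable_id.prodMk (measurable_pi_apply i))

lemma integrable_eval_pi {Ω : Type*} [MeasurableSpace Ω] {P : Measure Ω}
    [IsProbabilityMeasure P] {m : ℕ} {f : Ω → ℝ} (hf : Integrable f P) (i : Fin m) :
    Integrable (fun Z : Fin m → Ω => f (Z i)) (Measure.pi fun _ => P) :=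
  (measurePreserving_eval (fun _ : Fin m => P) i).integrable_comp_of_integrable hf

lemma integral_mean_comp_eval {Ω : Type*} [MeasurableSpace Ω] {P : Measure Ω}
    [IsProbabilityMeasure P] {m : ℕ} (hm : 0 < m) {f : Ω → ℝ} (hf : Integrable f P) :
    ∫ Z, (1 / (m : ℝ)) * ∑ i, f (Z i) ∂(Measure.pi fun _ : Fin m => P) = ∫ x, f x ∂P := by
  have hm' : (m : ℝ) ≠ 0 := by exact_mod_cast hm.ne'
  rw [integral_const_mul, integral_finsetSum _ fun i _ => integrable_eval_pi hf i]
  simp_rw [integral_comp_eval (μ := fun _ : Fin m => P) hf.aestronglyMeasurable]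
  simp [hm']

lemma measurable_lossRademacher (hl_meas : Measurable fun p : ℝ × ℝ => l p.1 p.2)
    {u : ℕ → EuclideanSpace ℝ (Fin K) → ℝ} (hu : ∀ k, Continuous (u k))
    {h : X → EuclideanSpace ℝ (Fin K)} (hh : Measurable h) :
    Measurable (lossRademacher (n := n) l u h) :=
  measurable_rademacherAverage (a := fun k i (z : Fin n → X × ℝ) => l (u k (h (z i).1)) (z i).2)
    fun k i => (measurable_loss_comp hl_meas (hu k) hh).comp (measurable_pi_apply i)

/-- The ghost sample step: the mean of `ψ` is the expected empirical mean on an independent sample.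
Since `ψ` need only be dominated by the supremum, not belong to the family, the lemma serves both
within a task and across tasks. -/
lemma integral_le_mean_add_integral_iSup {Ω : Type*} [MeasurableSpace Ω] (P : Measure Ω)
    [IsProbabilityMeasure P] {m : ℕ} (hm : 0 < m) {g : ℕ → Ω → ℝ} {ψ : Ω → ℝ}
    (hψi : Integrable ψ P) {z : Fin m → Ω}
    (hΦ : Integrable (fun z' => ⨆ k, ∑ i, (g k (z' i) - g k (z i)))
      (Measure.pi fun _ : Fin m => P))
    (hsup : ∀ z' : Fin m → Ω, ∑ i, (ψ (z' i) - ψ (z i)) ≤ ⨆ k, ∑ i, (g k (z' i) - g k (z i))) :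
    ∫ ω, ψ ω ∂P ≤ (1 / (m : ℝ)) * ∑ i, ψ (z i) +
      (1 / (m : ℝ)) * ∫ z', ⨆ k, ∑ i, (g k (z' i) - g k (z i)) ∂(Measure.pi fun _ : Fin m => P) := by
  have hsup' : ∀ z' : Fin m → Ω, ∑ i, ψ (z' i) ≤
      ∑ i, ψ (z i) + ⨆ k, ∑ i, (g k (z' i) - g k (z i)) := by
    intro z'
    have h := hsup z'
    rw [Finset.sum_sub_distrib] at h
    linarith
  have hsum : Integrable (fun z' : Fin m → Ω => ∑ i, ψ (z' i)) (Measure.pi fun _ => P) :=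
    integrable_finsetSum _ fun i _ => integrable_eval_pi hψi i
  have h := integral_mono hsum ((integrable_const _).add hΦ) hsup'
  rw [← integral_mean_comp_eval hm hψi, integral_const_mul, ← mul_add]
  refine mul_le_mul_of_nonneg_left (h.trans_eq ?_) (by positivity)
  simp only [Pi.add_apply]
  rw [integral_add (integrable_const _) hΦ]
  simp

lemma abs_iSup_sum_sub_le {Ω : Type*} {m : ℕ} {g : ℕ → Ω → ℝ}
    (hg01 : ∀ k ω, g k ω ∈ Set.Icc (0 : ℝ) 1) (z z' : Fin m → Ω) :
    |⨆ k, ∑ i, (g k (z' i) - g k (z i))| ≤ m :=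
  abs_iSup_le fun d => abs_sum_sub_le_of_mem_Icc (fun _ => hg01 d _) fun _ => hg01 d _

lemma integrable_iSup_sum_sub {Ω : Type*} [MeasurableSpace Ω] (P : Measure Ω)
    [IsProbabilityMeasure P] {m : ℕ} {g : ℕ → Ω → ℝ} (hg : ∀ k, Measurable (g k))
    (hg01 : ∀ k ω, g k ω ∈ Set.Icc (0 : ℝ) 1) (z : Fin m → Ω) :
    Integrable (fun z' => ⨆ k, ∑ i, (g k (z' i) - g k (z i)))
      (Measure.pi fun _ : Fin m => P) :=
  integrable_of_measurable_of_bound (Measurable.iSup fun d => Finset.measurable_fun_sum _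
      fun i _ => ((hg d).comp (measurable_pi_apply i)).sub_const _) m
    (abs_iSup_sum_sub_le hg01 z)

lemma measurable_integral_iSup_sum_sub {Ω : Type*} [MeasurableSpace Ω] (P : Measure Ω)
    [IsProbabilityMeasure P] {m : ℕ} {g : ℕ → Ω → ℝ} (hg : ∀ k, Measurable (g k)) :
    Measurable fun z : Fin m → Ω =>
      ∫ z', ⨆ k, ∑ i, (g k (z' i) - g k (z i)) ∂(Measure.pi fun _ : Fin m => P) := by
  have hΦm : Measurable fun q : (Fin m → Ω) × (Fin m → Ω) =>
      ⨆ k, ∑ i, (g k (q.2 i) - g k (q.1 i)) :=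
    Measurable.iSup fun d => Finset.measurable_fun_sum _ fun i _ =>
      ((hg d).comp ((measurable_pi_apply i).comp measurable_snd)).sub
        ((hg d).comp ((measurable_pi_apply i).comp measurable_fst))
  exact (hΦm.stronglyMeasurable.integral_prod_right
    (ν := Measure.pi fun _ : Fin m => P)).measurable

/-- Uniform estimation error of a data-dependent choice `ψ z` of a pointwise limit of the functions
`g k`. -/
lemma integral_integral_le_integral_mean_add {Ω : Type*} [MeasurableSpace Ω] (P : Measure Ω)
    [IsProbabilityMeasure P] {m : ℕ} (hm : 0 < m) {g : ℕ → Ω → ℝ} (hg : ∀ k, Measurable (g k))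
    (hg01 : ∀ k ω, g k ω ∈ Set.Icc (0 : ℝ) 1) {ψ : (Fin m → Ω) → Ω → ℝ}
    (hψm : ∀ z, Measurable (ψ z)) (hψ01 : ∀ z ω, ψ z ω ∈ Set.Icc (0 : ℝ) 1)
    (hψ : ∀ z, ∃ φ : ℕ → ℕ, ∀ ω,
      Filter.Tendsto (fun j => g (φ j) ω) Filter.atTop (nhds (ψ z ω)))
    (hr : Integrable (fun z => (1 / (m : ℝ)) * ∑ i, ψ z (z i)) (Measure.pi fun _ : Fin m => P)) :
    ∫ z, ∫ ω, ψ z ω ∂P ∂(Measure.pi fun _ : Fin m => P) ≤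
      ∫ z, (1 / (m : ℝ)) * ∑ i, ψ z (z i) ∂(Measure.pi fun _ : Fin m => P) +
        2 / m * ∫ z, rademacherAverage (fun k i => g k (z i)) ∂(Measure.pi fun _ : Fin m => P) := by
  have hΦint := integrable_of_measurable_of_bound (μ := Measure.pi fun _ : Fin m => P)
    (measurable_integral_iSup_sum_sub P hg) m
    fun z => abs_integral_le_of_abs_le (abs_iSup_sum_sub_le hg01 z)
  -- The left integrand is only known to be nonnegative; its measurability in `z` is not needed,
  -- because a nonintegrable function has integral 0.
  have h := integral_mono_of_nonneg (μ := Measure.pi fun _ : Fin m => P)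
    (f := fun z => ∫ ω, ψ z ω ∂P)
    (Filter.Eventually.of_forall fun z => integral_nonneg fun ω => (hψ01 z ω).1)
    (hr.add (hΦint.const_mul (1 / (m : ℝ)))) (Filter.Eventually.of_forall fun z => by
      obtain ⟨φ, hφ⟩ := hψ z
      refine integral_le_mean_add_integral_iSup P hm
        (integrable_of_measurable_of_bound (hψm z) 1 fun ω => abs_le_one_of_mem_Icc (hψ01 z ω))
        (integrable_iSup_sum_sub P hg hg01 z) fun z' => ?_
      have hlim : Filter.Tendsto (fun j => ∑ i, (g (φ j) (z' i) - g (φ j) (z i))) Filter.atTop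
          (nhds (∑ i, (ψ z (z' i) - ψ z (z i)))) :=
        tendsto_finsetSum _ fun i _ => (hφ _).sub (hφ _)
      exact le_of_tendsto' hlim fun j => le_ciSup (bddAbove_range_of_abs_le (B := m) fun k =>
        abs_sum_sub_le_of_mem_Icc (fun i => hg01 k (z' i)) fun i => hg01 k (z i)) (φ j))
  simp only [Pi.add_apply] at h
  rw [integral_add hr (hΦint.const_mul _)] at h
  have hsym := mul_le_mul_of_nonneg_left (integral_iSup_sum_sub_le_rademacherAverage P hg hg01 m)
    (by positivity : (0 : ℝ) ≤ 1 / m)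
  rw [← integral_const_mul] at hsym
  exact h.trans (add_le_add le_rfl (hsym.trans_eq (by ring)))

/-- The estimation error of specialization on one task. -/
lemma integral_risk_fhat_le (hn : 0 < n) (hl_meas : Measurable fun p : ℝ × ℝ => l p.1 p.2)
    (hl : ∀ u y, l u y ∈ Set.Icc (0 : ℝ) 1) (hl_lip : ∀ y, LipschitzWith 1 fun u => l u y)
    (hF_lip : ∀ f ∈ F, LipschitzWith L f) (hfhat : IsEmpiricalMinimizer l H F fhat)
    {h : X → EuclideanSpace ℝ (Fin K)} (hh : h ∈ H) (hh_meas : Measurable h)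
    (hfhat_meas : ∀ v, Measurable fun z => fhat h z v)
    {u : ℕ → EuclideanSpace ℝ (Fin K) → ℝ} (hu : ∀ k, u k ∈ F)
    (hu_dense : ∀ f ∈ F, ∃ φ : ℕ → ℕ, ∀ x,
      Filter.Tendsto (fun j => u (φ j) x) Filter.atTop (nhds (f x)))
    (P : Measure (X × ℝ)) [IsProbabilityMeasure P] :
    ∫ z, ∫ p, l (fhat h z (h p.1)) p.2 ∂P ∂(Measure.pi fun _ : Fin n => P) ≤
      ∫ z, minRisk l fhat h z ∂(Measure.pi fun _ : Fin n => P) +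
        2 / n * ∫ z, lossRademacher l u h z ∂(Measure.pi fun _ : Fin n => P) :=
  integral_integral_le_integral_mean_add P hn (g := fun k p => l (u k (h p.1)) p.2)
    (ψ := fun z p => l (fhat h z (h p.1)) p.2)
    (fun k => measurable_loss_comp hl_meas (hF_lip _ (hu k)).continuous hh_meas)
    (fun _ _ => hl _ _)
    (fun z => measurable_loss_comp hl_meas (hF_lip _ (hfhat h hh z).1).continuous hh_meas)
    (fun _ _ => hl _ _)
    (fun z => by
      obtain ⟨φ, hφ⟩ := hu_dense _ (hfhat h hh z).1
      exact ⟨φ, fun p => ((hl_lip p.2).continuous.tendsto _).comp (hφ _)⟩)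
    (integrable_of_measurable_of_bound
      (measurable_minRisk hl_meas hF_lip hfhat hh hh_meas hfhat_meas) 1 fun z =>
      abs_le_one_of_mem_Icc (minRisk_mem_Icc hl h z))

/-- The risk of a representation is at most its expected minimal empirical risk plus the expected
estimation error of specialization. -/
lemma environmentRisk_le (hn : 0 < n) (hl_meas : Measurable fun p : ℝ × ℝ => l p.1 p.2)
    (hl : ∀ u y, l u y ∈ Set.Icc (0 : ℝ) 1) (hl_lip : ∀ y, LipschitzWith 1 fun u => l u y)
    (hF_lip : ∀ f ∈ F, LipschitzWith L f) (hfhat : IsEmpiricalMinimizer l H F fhat)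
    {h : X → EuclideanSpace ℝ (Fin K)} (hh : h ∈ H) (hh_meas : Measurable h)
    (hfhat_meas : ∀ v, Measurable fun z => fhat h z v)
    {u : ℕ → EuclideanSpace ℝ (Fin K) → ℝ} (hu : ∀ k, u k ∈ F)
    (hu_dense : ∀ f ∈ F, ∃ φ : ℕ → ℕ, ∀ x,
      Filter.Tendsto (fun j => u (φ j) x) Filter.atTop (nhds (f x)))
    (η : Measure (ProbabilityMeasure (X × ℝ))) [IsProbabilityMeasure η] :
    environmentRisk l η fhat h ≤ ∫ z, minRisk l fhat h z ∂(sampleLaw n η) +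
      ∫ z, 2 / n * lossRademacher l u h z ∂(sampleLaw n η) := by
  have hmm := measurable_minRisk hl_meas hF_lip hfhat hh hh_meas hfhat_meas
  have hrm := measurable_lossRademacher (n := n) hl_meas
    (fun k => (hF_lip _ (hu k)).continuous) hh_meas
  have hb1 : ∀ z, |minRisk l fhat h z| ≤ 1 := fun z =>
    abs_le_one_of_mem_Icc (minRisk_mem_Icc hl h z)
  have hb2 : ∀ z : Fin n → X × ℝ, |2 / n * lossRademacher l u h z| ≤ 2 / n * n := fun z => by
    rw [abs_mul, abs_of_nonneg (by positivity)]
    exact mul_le_mul_of_nonneg_left (abs_lossRademacher_le hl u h z) (by positivity)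
  rw [integral_sampleLaw n η hmm hb1, integral_sampleLaw n η (hrm.const_mul _) hb2,
    ← integral_add (integrable_integral_pi hmm hb1 η)
      (integrable_integral_pi (hrm.const_mul _) hb2 η)]
  have hrhs := (integrable_integral_pi hmm hb1 η).add
    (integrable_integral_pi (hrm.const_mul _) hb2 η)
  unfold environmentRisk
  refine integral_mono_of_nonneg (Filter.Eventually.of_forall fun μ => ?_) hrhs
    (Filter.Eventually.of_forall fun μ => ?_)
  · exact integral_nonneg fun z => integral_nonneg fun p => (hl _ _).1
  simp only
  rw [integral_const_mul]
  exact integral_risk_fhat_le hn hl_meas hl hl_lip hF_lip hfhat hh hh_meas hfhat_meas hu hu_dense _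

/-- The expected minimal empirical risk is at most the optimal expected risk. -/
lemma integral_minRisk_le (hn : 0 < n) (hl_meas : Measurable fun p : ℝ × ℝ => l p.1 p.2)
    (hl : ∀ u y, l u y ∈ Set.Icc (0 : ℝ) 1) (hl_lip : ∀ y, LipschitzWith 1 fun u => l u y)
    (hF_lip : ∀ f ∈ F, LipschitzWith L f) (hfhat : IsEmpiricalMinimizer l H F fhat)
    {h : X → EuclideanSpace ℝ (Fin K)} (hh : h ∈ H) (hh_meas : Measurable h)
    (hfhat_meas : ∀ v, Measurable fun z => fhat h z v)
    {u : ℕ → EuclideanSpace ℝ (Fin K) → ℝ} (hu : ∀ k, u k ∈ F)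
    (hu_dense : ∀ f ∈ F, ∃ φ : ℕ → ℕ, ∀ x,
      Filter.Tendsto (fun j => u (φ j) x) Filter.atTop (nhds (f x)))
    (η : Measure (ProbabilityMeasure (X × ℝ))) [IsProbabilityMeasure η] :
    ∫ z, minRisk l fhat h z ∂(sampleLaw n η) ≤
      ∫ μ, ⨅ f : F, ∫ p, l (f.1 (h p.1)) p.2 ∂(μ : Measure (X × ℝ)) ∂η := by
  have hmm := measurable_minRisk hl_meas hF_lip hfhat hh hh_meas hfhat_meas
  have hFne : Nonempty F := ⟨⟨u 0, hu 0⟩⟩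
  have hlm : ∀ f ∈ F, Measurable fun p : X × ℝ => l (f (h p.1)) p.2 := fun f hf =>
    measurable_loss_comp hl_meas (hF_lip f hf).continuous hh_meas
  have hli : ∀ f ∈ F, ∀ μ : ProbabilityMeasure (X × ℝ),
      Integrable (fun p : X × ℝ => l (f (h p.1)) p.2) (μ : Measure (X × ℝ)) := fun f hf μ =>
    integrable_of_measurable_of_bound (hlm f hf) 1 fun p => abs_le_one_of_mem_Icc (hl _ _)
  have hb : ∀ (f : EuclideanSpace ℝ (Fin K) → ℝ) (μ : ProbabilityMeasure (X × ℝ)),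
      |∫ p, l (f (h p.1)) p.2 ∂(μ : Measure (X × ℝ))| ≤ 1 := fun f μ =>
    abs_integral_le_of_abs_le fun p => abs_le_one_of_mem_Icc (hl _ _)
  -- Reducing the infimum over `F` to a countable one, by dominated convergence along the dense
  -- sequence, makes it measurable in `μ`.
  have hinf : ∀ μ : ProbabilityMeasure (X × ℝ),
      ⨅ f : F, ∫ p, l (f.1 (h p.1)) p.2 ∂(μ : Measure (X × ℝ)) =
        ⨅ k, ∫ p, l (u k (h p.1)) p.2 ∂(μ : Measure (X × ℝ)) := by
    intro μ
    refine le_antisymm (le_ciInf fun k => ciInf_le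
      (bddBelow_range_of_abs_le fun f : F => hb f.1 μ) ⟨u k, hu k⟩) (le_ciInf fun f => ?_)
    obtain ⟨φ, hφ⟩ := hu_dense f.1 f.2
    have hlim : Filter.Tendsto (fun j => ∫ p, l (u (φ j) (h p.1)) p.2 ∂(μ : Measure (X × ℝ)))
        Filter.atTop (nhds (∫ p, l (f.1 (h p.1)) p.2 ∂(μ : Measure (X × ℝ)))) := by
      refine tendsto_integral_of_dominated_convergence (fun _ => 1)
        (fun j => (hlm _ (hu _)).aestronglyMeasurable) (integrable_const _)
        (fun j => Filter.Eventually.of_forall fun p => abs_le_one_of_mem_Icc (hl _ _))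
        (Filter.Eventually.of_forall fun p => ?_)
      exact ((hl_lip _).continuous.tendsto _).comp (hφ _)
    exact ge_of_tendsto' hlim fun j =>
      ciInf_le (bddBelow_range_of_abs_le fun k => hb (u k) μ) (φ j)
  have hint : Integrable (fun μ : ProbabilityMeasure (X × ℝ) =>
      ⨅ f : F, ∫ p, l (f.1 (h p.1)) p.2 ∂(μ : Measure (X × ℝ))) η := by
    refine integrable_of_measurable_of_bound ?_ 1 fun μ => abs_iInf_le fun f => hb f.1 μ
    simp only [hinf]
    exact Measurable.iInf fun k => measurable_integral_probabilityMeasure (hlm _ (hu k))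
  have hb1 : ∀ z, |minRisk l fhat h z| ≤ 1 := fun z =>
    abs_le_one_of_mem_Icc (minRisk_mem_Icc hl h z)
  rw [integral_sampleLaw n η hmm hb1]
  refine integral_mono_of_nonneg (Filter.Eventually.of_forall fun μ => ?_) hint
    (Filter.Eventually.of_forall fun μ => le_ciInf fun f => ?_)
  · exact integral_nonneg fun z => (minRisk_mem_Icc hl h z).1
  simp only
  -- The true risk of a fixed `f` is its expected empirical risk, which dominates the expected
  -- minimum.
  rw [← integral_mean_comp_eval hn (hli f.1 f.2 μ)]
  exact integral_mono (integrable_of_measurable_of_bound hmm 1 hb1)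
    ((integrable_finsetSum _ fun i _ =>
      integrable_eval_pi (hli f.1 f.2 μ) i).const_mul _) fun z => (hfhat h hh z).2 f.1 f.2

end Risks

/-! ### Gaussian complexity bounds -/

section Complexity

variable {X : Type*} {K T n : ℕ} {l : ℝ → ℝ → ℝ} {H : Set (X → EuclideanSpace ℝ (Fin K))}
  {F : Set (EuclideanSpace ℝ (Fin K) → ℝ)} {L : NNReal}
  {fhat : (X → EuclideanSpace ℝ (Fin K)) → (Fin n → X × ℝ) → EuclideanSpace ℝ (Fin K) → ℝ}

lemma gaussianAverage_mono {ι : Type*} [Fintype ι] {S S' : Set (ι → ℝ)} (h : S ⊆ S') :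
    gaussianAverage S ≤ gaussianAverage S' :=
  extExpectation_mono fun _ => biSup_mono h

lemma rademacherAverage_const_mul {D : Type*} {m : ℕ} {c : ℝ} (hc : 0 ≤ c) (a : D → Fin m → ℝ) :
    rademacherAverage (fun d i => c * a d i) = c * rademacherAverage a := by
  unfold rademacherAverage
  rw [mul_left_comm c, Finset.mul_sum (a := c)]
  simp only [Real.mul_iSup_of_nonneg hc, Finset.mul_sum, mul_left_comm c]

lemma two_mul_sqrt_pi_div_two : 2 * √(Real.pi / 2) = √(2 * Real.pi) := by
  rw [show 2 * Real.pi = 2 ^ 2 * (Real.pi / 2) by ring, Real.sqrt_mul (by positivity),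
    Real.sqrt_sq zero_le_two]

lemma rademacherAverage_minRisk_le (hn : 0 < n) (hL : 0 < L)
    (hl_lip : ∀ y, LipschitzWith 1 fun u => l u y)
    (hF_lip : ∀ f ∈ F, LipschitzWith L f) (hfhat : IsEmpiricalMinimizer l H F fhat)
    {D : Type*} [Nonempty D] (d : D → X → EuclideanSpace ℝ (Fin K)) (hd : ∀ k, d k ∈ H)
    (Z : Fin T → Fin n → X × ℝ) :
    ((2 / T * rademacherAverage (fun k t => minRisk l fhat (d k) (Z t)) : ℝ) : EReal) ≤
      ((√(2 * Real.pi) * L / (T * √n) : ℝ) : EReal) * gaussianAverage (representationSet H Z) := by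
  have hn' : (0 : ℝ) < √n := Real.sqrt_pos.2 (by exact_mod_cast hn)
  have hL' : (0 : ℝ) < L := by exact_mod_cast hL
  -- The factor √n / L normalizes the Lipschitz constant of `minRisk` to 1; it is undone at the end.
  have hcon := rademacherAverage_le_gaussianAverage
    (ψ := fun k t => √n / L * minRisk l fhat (d k) (Z t))
    (fun k (p : Fin T × Fin n × Fin K) => d k (Z p.1 p.2.1).1 p.2.2) (fun k k' t => by
      rw [← mul_sub, abs_mul, abs_of_pos (by positivity)]
      have h := abs_minRisk_sub_le_sqrt hn hl_lip hF_lip hfhat (hd k) (hd k') (Z t)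
      refine (mul_le_mul_of_nonneg_left h (by positivity)).trans (le_of_eq ?_)
      rw [← mul_assoc, div_mul_div_cancel₀ hL'.ne', div_self hn'.ne', one_mul])
  have hmono : gaussianAverage (Set.range fun k (p : Fin T × Fin n × Fin K) =>
      d k (Z p.1 p.2.1).1 p.2.2) ≤ gaussianAverage (representationSet H Z) :=
    gaussianAverage_mono (by rintro _ ⟨k, rfl⟩; exact ⟨d k, hd k, rfl⟩)
  have hcon' := hcon.trans (mul_le_mul_of_nonneg_left hmono
    (EReal.coe_nonneg.2 (Real.sqrt_nonneg _)))
  rw [rademacherAverage_const_mul (by positivity)] at hcon'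
  have hfin := mul_le_mul_of_nonneg_left hcon'
    (EReal.coe_nonneg.2 (by positivity : (0 : ℝ) ≤ 2 * L / (T * √n)))
  have e1 : 2 * L / (T * √n) * √(Real.pi / 2) = √(2 * Real.pi) * L / (T * √n) := by
    rw [← two_mul_sqrt_pi_div_two]; ring
  have e2 : 2 * L / (T * √n) * (√n / L * rademacherAverage
      (fun k t => minRisk l fhat (d k) (Z t))) =
      2 / T * rademacherAverage (fun k t => minRisk l fhat (d k) (Z t)) := by
    field_simp
  rwa [← EReal.coe_mul, e2, ← mul_assoc, ← EReal.coe_mul, e1] at hfin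

lemma exists_ne_zero_piLp (hK : 0 < K) (hn : 0 < n) :
    ∃ y : PiLp 2 fun _ : Fin n => EuclideanSpace ℝ (Fin K), y ≠ 0 := by
  refine ⟨WithLp.toLp 2 fun _ => WithLp.toLp 2 fun _ => 1, fun h => ?_⟩
  have := congrArg (fun y : PiLp 2 fun _ : Fin n => EuclideanSpace ℝ (Fin K) =>
    y ⟨0, hn⟩ ⟨0, hK⟩) h
  simp at this

lemma qPrime_nonneg (hK : 0 < K) (hn : 0 < n) (hF : F.Nonempty) : 0 ≤ qPrime n F := by
  obtain ⟨y, hy⟩ := exists_ne_zero_piLp hK hn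
  exact le_iSup₂_of_le y hy (mul_nonneg (EReal.coe_nonneg.2 (by positivity))
    (gaussianAverage_nonneg (hF.image _)))

lemma gaussianAverage_le_of_qPrime (hF : F.Nonempty) {q : ℝ} (hq : qPrime n F = q)
    {y : PiLp 2 fun _ : Fin n => EuclideanSpace ℝ (Fin K)} (hy : y ≠ 0) :
    gaussianAverage ((fun f (i : Fin n) => f (y i)) '' F) ≤ ((q * ‖y‖ : ℝ) : EReal) := by
  have h : ((1 / ‖y‖ : ℝ) : EReal) * gaussianAverage ((fun f (i : Fin n) => f (y i)) '' F) ≤ q := by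
    rw [← hq]
    exact le_iSup₂_of_le y hy le_rfl
  have h0 : 0 ≤ gaussianAverage ((fun f (i : Fin n) => f (y i)) '' F) :=
    gaussianAverage_nonneg (hF.image _)
  have hy' : 0 < ‖y‖ := norm_pos_iff.2 hy
  generalize gaussianAverage ((fun f (i : Fin n) => f (y i)) '' F) = G at h h0
  induction G with
  | bot => simp at h0
  | top =>
    rw [EReal.coe_mul_top_of_pos (by positivity)] at h
    exact absurd h (by simp)
  | coe g =>
    rw [← EReal.coe_mul, EReal.coe_le_coe_iff, one_div, inv_mul_le_iff₀ hy'] at h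
    exact EReal.coe_le_coe_iff.2 (by linarith)

/-- The supremum defining `qPrime` omits the zero vector, but a represented sample may vanish;
continuity fills the gap. -/
lemma le_of_forall_ne_zero_le {V : Type*} [NormedAddCommGroup V] [NormedSpace ℝ V] [Nontrivial V]
    {f g : V → ℝ} (hf : Continuous f) (hg : Continuous g) (h : ∀ y, y ≠ 0 → f y ≤ g y) (y : V) :
    f y ≤ g y := by
  by_cases hy : y = 0
  · subst hy
    have : (nhdsWithin (0 : V) {0}ᶜ).NeBot := Module.punctured_nhds_neBot ℝ V 0
    have hev : ∀ᶠ y in nhdsWithin (0 : V) {0}ᶜ, f y ≤ g y :=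
      eventually_nhdsWithin_of_forall fun y hy => h y hy
    exact le_of_tendsto_of_tendsto ((hf.tendsto 0).mono_left nhdsWithin_le_nhds)
      ((hg.tendsto 0).mono_left nhdsWithin_le_nhds) hev
  · exact h y hy

lemma rademacherAverage_loss_le (hK : 0 < K) (hn : 0 < n)
    (hl : ∀ u y, l u y ∈ Set.Icc (0 : ℝ) 1) (hl_lip : ∀ y, LipschitzWith 1 fun u => l u y)
    (hF_lip : ∀ f ∈ F, LipschitzWith L f) {q : ℝ} (hq : qPrime n F = q)
    {u : ℕ → EuclideanSpace ℝ (Fin K) → ℝ} (hu : ∀ k, u k ∈ F) (w : Fin n → ℝ)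
    (y : PiLp 2 fun _ : Fin n => EuclideanSpace ℝ (Fin K)) :
    rademacherAverage (fun k i => l (u k (y i)) (w i)) ≤ √(Real.pi / 2) * (q * ‖y‖) := by
  have hne : ∀ y : PiLp 2 fun _ : Fin n => EuclideanSpace ℝ (Fin K), y ≠ 0 →
      rademacherAverage (fun k i => l (u k (y i)) (w i)) ≤ √(Real.pi / 2) * (q * ‖y‖) := by
    intro y hy
    have hcon := rademacherAverage_le_gaussianAverage_scalar
      (ψ := fun k i => l (u k (y i)) (w i)) (fun k i => u k (y i))
      (fun k k' i => abs_loss_sub_le hl_lip _ _ _)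
    have hmono : gaussianAverage (Set.range fun k i => u k (y i)) ≤
        gaussianAverage ((fun f (i : Fin n) => f (y i)) '' F) :=
      gaussianAverage_mono (by rintro _ ⟨k, rfl⟩; exact ⟨u k, hu k, rfl⟩)
    have h := hcon.trans (mul_le_mul_of_nonneg_left
      (hmono.trans (gaussianAverage_le_of_qPrime ⟨u 0, hu 0⟩ hq hy))
      (EReal.coe_nonneg.2 (Real.sqrt_nonneg _)))
    rwa [← EReal.coe_mul, EReal.coe_le_coe_iff] at h
  have hcont : Continuous fun y : PiLp 2 fun _ : Fin n => EuclideanSpace ℝ (Fin K) =>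
      rademacherAverage (fun k i => l (u k (y i)) (w i)) := by
    refine continuous_iff_continuousAt.2 fun y => tendsto_iff_dist_tendsto_zero.2 ?_
    have hc : Continuous fun y' : PiLp 2 fun _ : Fin n => EuclideanSpace ℝ (Fin K) =>
        ∑ i, (L : ℝ) * ‖y' i - y i‖ := by fun_prop
    have ht := hc.tendsto y
    simp only [sub_self, norm_zero, Finset.sum_const_zero, mul_zero] at ht
    refine squeeze_zero (fun _ => dist_nonneg) (fun y' => ?_) ht
    rw [Real.dist_eq]
    exact abs_rademacherAverage_sub_le (B := 1) (fun k i => abs_le_one_of_mem_Icc (hl _ _))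
      (fun k i => abs_le_one_of_mem_Icc (hl _ _)) fun k => Finset.sum_le_sum fun i _ =>
        (abs_loss_sub_le hl_lip _ _ _).trans (abs_sub_le_of_lipschitzWith (hF_lip _ (hu k)) _ _)
  obtain ⟨y₁, hy₁⟩ := exists_ne_zero_piLp hK hn
  have : Nontrivial (PiLp 2 fun _ : Fin n => EuclideanSpace ℝ (Fin K)) := ⟨y₁, 0, hy₁⟩
  exact le_of_forall_ne_zero_le hcont (continuous_const.mul (continuous_const.mul continuous_norm))
    hne y

lemma lossRademacher_le (hK : 0 < K) (hn : 0 < n)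
    (hl : ∀ u y, l u y ∈ Set.Icc (0 : ℝ) 1) (hl_lip : ∀ y, LipschitzWith 1 fun u => l u y)
    (hF_lip : ∀ f ∈ F, LipschitzWith L f) {q : ℝ} (hq : qPrime n F = q)
    {u : ℕ → EuclideanSpace ℝ (Fin K) → ℝ} (hu : ∀ k, u k ∈ F)
    (h : X → EuclideanSpace ℝ (Fin K)) (z : Fin n → X × ℝ) :
    2 / n * lossRademacher l u h z ≤ √(2 * Real.pi) / n * q * ‖representedSample h z‖ := by
  have h1 := rademacherAverage_loss_le hK hn hl hl_lip hF_lip hq hu (fun i => (z i).2)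
    (representedSample h z)
  refine (mul_le_mul_of_nonneg_left h1 (by positivity)).trans (le_of_eq ?_)
  rw [← two_mul_sqrt_pi_div_two]
  ring

lemma enorm_representedSample_sq (h : X → EuclideanSpace ℝ (Fin K)) (z : Fin n → X × ℝ) :
    ‖representedSample h z‖ₑ ^ 2 = ∑ i, ‖h (z i).1‖ₑ ^ 2 := by
  simp only [← ofReal_norm, ← ENNReal.ofReal_pow (norm_nonneg _)]
  rw [PiLp.norm_sq_eq_of_L2, ENNReal.ofReal_sum_of_nonneg fun _ _ => sq_nonneg _]
  rfl

variable [MeasurableSpace X]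

lemma measurable_enorm_representedSample {h : X → EuclideanSpace ℝ (Fin K)} (hh : Measurable h) :
    Measurable fun z : Fin n → X × ℝ => ‖representedSample h z‖ₑ := by
  have : Measurable fun z : Fin n → X × ℝ => representedSample h z := by
    unfold representedSample
    exact (WithLp.measurable_toLp 2 _).comp (measurable_pi_lambda _ fun i =>
      hh.comp (measurable_fst.comp (measurable_pi_apply i)))
  exact this.enorm

/-- The Cauchy–Schwarz inequality bounds the mean norm by the root of the mean square, which is `n`
times the second moment under `mixture η`. Factoring out `n` prepares the cancellation with the 1/n
of the estimation error. -/
lemma lintegral_enorm_representedSample_le (hn : 0 < n) {h : X → EuclideanSpace ℝ (Fin K)}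
    (hh : Measurable h) (η : Measure (ProbabilityMeasure (X × ℝ))) [IsProbabilityMeasure η] :
    ∫⁻ z, ‖representedSample h z‖ₑ ∂(sampleLaw n η) ≤
      n * ((∫⁻ p, ‖h p.1‖ₑ ^ 2 ∂(mixture η)) / n) ^ (1 / 2 : ℝ) := by
  have hm := measurable_enorm_representedSample (n := n) hh
  have hn0 : (n : ENNReal) ≠ 0 := by exact_mod_cast hn.ne'
  have hnt : (n : ENNReal) ≠ ⊤ := ENNReal.natCast_ne_top n
  have hcs := ENNReal.lintegral_mul_le_Lp_mul_Lq (sampleLaw n η) Real.HolderConjugate.two_two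
    hm.aemeasurable (g := fun _ => 1) aemeasurable_const
  simp only [Pi.mul_apply, mul_one, lintegral_const, measure_univ,
    ENNReal.rpow_two] at hcs
  refine hcs.trans (le_of_eq ?_)
  simp only [enorm_representedSample_sq]
  rw [lintegral_sum_sampleLaw n η (f := fun p => ‖h p.1‖ₑ ^ 2)
    ((hh.comp measurable_fst).enorm.pow_const 2)]
  generalize ∫⁻ p, ‖h p.1‖ₑ ^ 2 ∂(mixture η) = M
  have h1 : (n : ENNReal) * M = n ^ (2 : ℝ) * (M / n) := by
    rw [ENNReal.rpow_two, sq, mul_assoc, ENNReal.mul_div_cancel hn0 hnt]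
  rw [h1, ENNReal.mul_rpow_of_nonneg _ _ (by norm_num), ← ENNReal.rpow_mul]
  norm_num

end Complexity

/-! ### Uniform deviations with an empirical complexity -/

section UniformDeviation

variable {Ω : Type*}

lemma sum_abs_update_sub_update_le {m : ℕ} {c : ℝ} {f : Ω → ℝ} (hf : ∀ x y, |f x - f y| ≤ c)
    (Z : Fin m → Ω) (i : Fin m) (x y : Ω) :
    ∑ t, |f (Function.update Z i x t) - f (Function.update Z i y t)| ≤ c := by
  rw [Finset.sum_eq_single i]
  · simpa using hf x y
  · intro t _ ht
    simp [Function.update_of_ne ht]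
  · simp

lemma abs_sum_update_sub_update_le {m : ℕ} {c : ℝ} {f : Ω → ℝ} (hf : ∀ x y, |f x - f y| ≤ c)
    (Z : Fin m → Ω) (i : Fin m) (x y : Ω) :
    |∑ t, f (Function.update Z i x t) - ∑ t, f (Function.update Z i y t)| ≤ c := by
  rw [← Finset.sum_sub_distrib]
  exact (Finset.abs_sum_le_sum_abs _ _).trans (sum_abs_update_sub_update_le hf Z i x y)

lemma abs_sub_le_of_mem_Icc {a b c : ℝ} (ha : a ∈ Set.Icc 0 c) (hb : b ∈ Set.Icc 0 c) :
    |a - b| ≤ c :=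
  abs_le.2 ⟨by linarith [ha.1, hb.2], by linarith [ha.2, hb.1]⟩

variable [MeasurableSpace Ω]

/-- With probability at least `1 - δ`, the expected uniform deviation of a second sample plus the
minimal empirical mean is controlled by the empirical Rademacher average, the expected minimal
empirical mean and the deviation of the empirical mean of `V`. -/
theorem measure_uniform_deviation_ge (P : Measure Ω) [IsProbabilityMeasure P] {m : ℕ} (hm : 0 < m)
    {g : ℕ → Ω → ℝ} (hg : ∀ k, Measurable (g k)) (hg01 : ∀ k ω, g k ω ∈ Set.Icc (0 : ℝ) 1)
    {V : Ω → ℝ} (hV : Measurable V) {b : ℝ} (hb : 0 ≤ b) (hVb : ∀ ω, V ω ∈ Set.Icc 0 b)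
    {δ : ℝ} (hδ : 0 < δ) {s : ℝ} (hs0 : 0 ≤ s)
    (hs : (4 + b) ^ 2 / m * Real.log (1 / δ) ≤ 2 * s ^ 2) :
    ∃ E : Set (Fin m → Ω), MeasurableSet E ∧
      ENNReal.ofReal (1 - δ) ≤ (Measure.pi fun _ : Fin m => P) E ∧ ∀ Z ∈ E,
        (1 / (m : ℝ)) * ∫ Z', ⨆ k, ∑ i, (g k (Z' i) - g k (Z i)) ∂(Measure.pi fun _ : Fin m => P) +
          (⨅ k, (1 / (m : ℝ)) * ∑ i, g k (Z i)) + ∫ ω, V ω ∂P ≤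
        2 / m * rademacherAverage (fun k i => g k (Z i)) + (1 / (m : ℝ)) * ∑ i, V (Z i) +
          ∫ Z', ⨅ k, (1 / (m : ℝ)) * ∑ i, g k (Z' i) ∂(Measure.pi fun _ : Fin m => P) + s := by
  have hm' : (0 : ℝ) < m := by exact_mod_cast hm
  set μ := Measure.pi fun _ : Fin m => P with hμ
  set Ψ : (Fin m → Ω) → ℝ := fun Z => ∫ Z', ⨆ k, ∑ i, (g k (Z' i) - g k (Z i)) ∂μ with hΨ
  set M : (Fin m → Ω) → ℝ := fun Z => ⨅ k, (1 / (m : ℝ)) * ∑ i, g k (Z i) with hM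
  set R : (Fin m → Ω) → ℝ := fun Z => rademacherAverage (fun k i => g k (Z i)) with hR
  set A : (Fin m → Ω) → ℝ := fun Z => ∑ i, V (Z i) with hA
  have hΨm : Measurable Ψ := measurable_integral_iSup_sum_sub P hg
  have hMm : Measurable M := Measurable.iInf fun k => (Finset.measurable_fun_sum _ fun i _ =>
    (hg k).comp (measurable_pi_apply i)).const_mul _
  have hRm : Measurable R := measurable_rademacherAverage
    (a := fun k i (Z : Fin m → Ω) => g k (Z i)) fun k i => (hg k).comp (measurable_pi_apply i)
  have hAm : Measurable A := Finset.measurable_fun_sum _ fun i _ => hV.comp (measurable_pi_apply i)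
  have hΨb : ∀ Z, |Ψ Z| ≤ m := fun Z => abs_integral_le_of_abs_le (abs_iSup_sum_sub_le hg01 Z)
  have hMb' : ∀ (Z : Fin m → Ω) k, |(1 / (m : ℝ)) * ∑ i, g k (Z i)| ≤ 1 := fun Z k =>
    abs_le_one_of_mem_Icc (mean_mem_Icc fun i => hg01 k (Z i))
  have hMb : ∀ Z, |M Z| ≤ 1 := fun Z => abs_iInf_le (hMb' Z)
  have hRb : ∀ Z, |R Z| ≤ m * 1 := fun Z =>
    abs_rademacherAverage_le fun k i => abs_le_one_of_mem_Icc (hg01 k (Z i))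
  have hAb : ∀ Z, |A Z| ≤ m * b := fun Z => (Finset.abs_sum_le_sum_abs _ _).trans
    ((Finset.sum_le_sum (g := fun _ => b) fun i _ =>
      abs_le.2 ⟨by linarith [(hVb (Z i)).1], (hVb (Z i)).2⟩).trans (by simp))
  have hgd : ∀ k x y, |g k x - g k y| ≤ 1 := fun k x y =>
    abs_sub_le_of_mem_Icc (hg01 k x) (hg01 k y)
  have hΨd : ∀ Z i x y, |Ψ (Function.update Z i x) - Ψ (Function.update Z i y)| ≤ 1 := by
    intro Z i x y
    rw [hΨ]
    simp only
    rw [← integral_sub (integrable_iSup_sum_sub P hg hg01 _)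
      (integrable_iSup_sum_sub P hg hg01 _)]
    refine abs_integral_le_of_abs_le fun Z' => abs_iSup_sub_iSup_le
      (fun k => abs_sum_sub_le_of_mem_Icc (fun i => hg01 k _) fun i => hg01 k _)
      (fun k => abs_sum_sub_le_of_mem_Icc (fun i => hg01 k _) fun i => hg01 k _) fun k => ?_
    rw [Finset.sum_sub_distrib, Finset.sum_sub_distrib, sub_sub_sub_cancel_left]
    exact abs_sum_update_sub_update_le (hgd k) Z i y x
  have hMd : ∀ Z i x y, |M (Function.update Z i x) - M (Function.update Z i y)| ≤ 1 / m := by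
    intro Z i x y
    refine abs_iInf_sub_iInf_le (hMb' _) (hMb' _) fun k => ?_
    rw [← mul_sub, abs_mul, abs_of_nonneg (by positivity)]
    exact (mul_le_mul_of_nonneg_left (abs_sum_update_sub_update_le (hgd k) Z i x y)
      (by positivity)).trans_eq (mul_one _)
  have hRd : ∀ Z i x y, |R (Function.update Z i x) - R (Function.update Z i y)| ≤ 1 := fun Z i x y =>
    abs_rademacherAverage_sub_le (fun k t => abs_le_one_of_mem_Icc (hg01 k _))
      (fun k t => abs_le_one_of_mem_Icc (hg01 k _)) fun k =>
      sum_abs_update_sub_update_le (hgd k) Z i x y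
  have hAd : ∀ Z i x y, |A (Function.update Z i x) - A (Function.update Z i y)| ≤ b :=
    fun Z i x y => abs_sum_update_sub_update_le
      (fun x y => abs_sub_le_of_mem_Icc (hVb x) (hVb y)) Z i x y
  -- All random quantities of the bound are gathered in one function, so that a single concentration
  -- step suffices.
  set W : (Fin m → Ω) → ℝ := fun Z =>
    (1 / m) * Ψ Z + M Z - 2 / m * R Z - 1 / m * A Z with hW
  have hWm : Measurable W := by fun_prop
  have habs4 : ∀ p q r t : ℝ, |p + q - r - t| ≤ |p| + |q| + |r| + |t| := fun p q r t =>
    ((abs_sub _ _).trans (add_le_add_left ((abs_sub _ _).trans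
      (add_le_add_left (abs_add_le _ _) _)) _))
  have h1m : (0 : ℝ) ≤ 1 / m := by positivity
  have h2m : (0 : ℝ) ≤ 2 / m := by positivity
  have hWb : ∀ Z, |W Z| ≤ 1 / m * m + 1 + 2 / m * (m * 1) + 1 / m * (m * b) := by
    intro Z
    refine (habs4 _ _ _ _).trans ?_
    rw [abs_mul, abs_mul, abs_mul, abs_of_nonneg h1m, abs_of_nonneg h2m]
    have e1 := mul_le_mul_of_nonneg_left (hΨb Z) h1m
    have e2 := mul_le_mul_of_nonneg_left (hRb Z) h2m
    have e3 := mul_le_mul_of_nonneg_left (hAb Z) h1m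
    linarith [hMb Z]
  have hWd : ∀ Z i x y, |W (Function.update Z i x) - W (Function.update Z i y)| ≤
      (4 + b) / m := by
    intro Z i x y
    have e : W (Function.update Z i x) - W (Function.update Z i y) =
        1 / m * (Ψ (Function.update Z i x) - Ψ (Function.update Z i y)) +
        (M (Function.update Z i x) - M (Function.update Z i y)) -
        2 / m * (R (Function.update Z i x) - R (Function.update Z i y)) -
        1 / m * (A (Function.update Z i x) - A (Function.update Z i y)) := by
      simp only [hW]; ring
    rw [e]
    refine (habs4 _ _ _ _).trans ?_
    rw [abs_mul, abs_mul, abs_mul, abs_of_nonneg h1m, abs_of_nonneg h2m]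
    have e1 := mul_le_mul_of_nonneg_left (hΨd Z i x y) h1m
    have e2 := mul_le_mul_of_nonneg_left (hRd Z i x y) h2m
    have e3 := mul_le_mul_of_nonneg_left (hAd Z i x y) h1m
    -- The contributions of `Ψ`, `M`, twice `R`, and `A` to the bounded difference.
    have e4 : (4 + b) / m = 1 / m * 1 + 1 / m + 2 / m * 1 + 1 / m * b := by ring
    linarith [hMd Z i x y]
  have hΨi : Integrable Ψ μ := integrable_of_measurable_of_bound hΨm _ hΨb
  have hMi : Integrable M μ := integrable_of_measurable_of_bound hMm _ hMb
  have hRi : Integrable R μ := integrable_of_measurable_of_bound hRm _ hRb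
  have hAi : Integrable A μ := integrable_of_measurable_of_bound hAm _ hAb
  have hVi : Integrable V P := integrable_of_measurable_of_bound hV b fun ω =>
    abs_le.2 ⟨by linarith [(hVb ω).1], (hVb ω).2⟩
  have hmeanA : ∫ Z, 1 / (m : ℝ) * A Z ∂μ = ∫ ω, V ω ∂P := integral_mean_comp_eval hm hVi
  have hsym : ∫ Z, Ψ Z ∂μ ≤ 2 * ∫ Z, R Z ∂μ :=
    integral_iSup_sum_sub_le_rademacherAverage P hg hg01 m
  -- By symmetrization the mean of the `Ψ` term is absorbed by that of the `R` term.
  have hmean : ∫ Z, W Z ∂μ ≤ ∫ Z, M Z ∂μ - ∫ ω, V ω ∂P := by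
    have i1 : Integrable (fun Z => 1 / (m : ℝ) * Ψ Z + M Z) μ := (hΨi.const_mul _).add hMi
    have i2 : Integrable (fun Z => 1 / (m : ℝ) * Ψ Z + M Z - 2 / m * R Z) μ :=
      i1.sub (hRi.const_mul _)
    have hw : ∫ Z, W Z ∂μ = 1 / m * ∫ Z, Ψ Z ∂μ + ∫ Z, M Z ∂μ - 2 / m * ∫ Z, R Z ∂μ -
        ∫ ω, V ω ∂P := by
      rw [← hmeanA, ← integral_const_mul, ← integral_const_mul (2 / (m : ℝ)),
        ← integral_add (hΨi.const_mul _) hMi, ← integral_sub i1 (hRi.const_mul _),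
        ← integral_sub i2 (hAi.const_mul _)]
    have := mul_le_mul_of_nonneg_left hsym h1m
    have e : 1 / (m : ℝ) * (2 * ∫ Z, R Z ∂μ) = 2 / m * ∫ Z, R Z ∂μ := by ring
    linarith
  refine ⟨{Z | W Z ≤ ∫ Z', W Z' ∂μ + s}, measurableSet_le hWm measurable_const, ?_, ?_⟩
  · refine measure_le_integral_add_of_bounded_differences hm hWm hWb (c := (4 + b) / m)
      (by positivity) hWd hδ hs0 ((le_of_eq ?_).trans hs)
    field_simp
  · intro Z hZ
    have hZ' : W Z ≤ ∫ Z', W Z' ∂μ + s := hZ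
    simp only [hW] at hZ' hmean
    linarith

end UniformDeviation

/-! ### Excess risk of multitask representation learning -/

section ExcessRisk

variable {X : Type*} {K T n : ℕ} {l : ℝ → ℝ → ℝ}
  {H : Set (X → EuclideanSpace ℝ (Fin K))}
  {F : Set (EuclideanSpace ℝ (Fin K) → ℝ)} {L : NNReal}
  {fhat : (X → EuclideanSpace ℝ (Fin K)) → (Fin n → X × ℝ) → EuclideanSpace ℝ (Fin K) → ℝ}

/-- The supremum over a sequence of representations of the estimation errors of specialization,
truncated at `2`. -/
def truncatedError (c : ℝ) (d : ℕ → X → EuclideanSpace ℝ (Fin K)) (z : Fin n → X × ℝ) : ENNReal :=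
  min 2 (ENNReal.ofReal c * ⨆ k, ‖representedSample (d k) z‖ₑ)

lemma truncatedError_ne_top {c : ℝ} {d : ℕ → X → EuclideanSpace ℝ (Fin K)} {z : Fin n → X × ℝ} :
    truncatedError c d z ≠ ⊤ :=
  ((min_le_left _ _).trans_lt (by simp)).ne

lemma toReal_truncatedError_mem_Icc {c : ℝ} {d : ℕ → X → EuclideanSpace ℝ (Fin K)}
    {z : Fin n → X × ℝ} : (truncatedError c d z).toReal ∈ Set.Icc (0 : ℝ) 2 :=
  ⟨ENNReal.toReal_nonneg, by
    simpa [truncatedError] using ENNReal.toReal_mono (by simp) (min_le_left (2 : ENNReal) _)⟩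

lemma lossRademacher_le_truncatedError (hK : 0 < K) (hn : 0 < n)
    (hl : ∀ u y, l u y ∈ Set.Icc (0 : ℝ) 1) (hl_lip : ∀ y, LipschitzWith 1 fun u => l u y)
    (hF_lip : ∀ f ∈ F, LipschitzWith L f) {q : ℝ} (hq : qPrime n F = q) (hq0 : 0 ≤ q)
    {u : ℕ → EuclideanSpace ℝ (Fin K) → ℝ} (hu : ∀ k, u k ∈ F) {d : ℕ → H} (hd : DenseRange d)
    (h : H) (z : Fin n → X × ℝ) :
    2 / n * lossRademacher l u h.1 z ≤
      (truncatedError (√(2 * Real.pi) / n * q) (fun k => (d k).1) z).toReal := by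
  have hn' : (n : ℝ) ≠ 0 := by exact_mod_cast hn.ne'
  refine (ENNReal.ofReal_le_iff_le_toReal truncatedError_ne_top).1 (le_min ?_ ?_)
  -- Truncation at 2 loses nothing: losses in [0, 1] have Rademacher average at most `n`.
  · rw [ENNReal.ofReal_le_iff_le_toReal (by simp), ENNReal.toReal_ofNat]
    have h1 := (le_abs_self _).trans (abs_lossRademacher_le hl u h.1 z)
    refine (mul_le_mul_of_nonneg_left h1 (by positivity)).trans (le_of_eq ?_)
    field_simp
  · have h1 := ENNReal.ofReal_le_ofReal (lossRademacher_le hK hn hl hl_lip hF_lip hq hu h.1 z)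
    rw [ENNReal.ofReal_mul (p := √(2 * Real.pi) / n * q) (by positivity), ofReal_norm] at h1
    refine h1.trans (mul_le_mul_right ?_ _)
    have hcont : Continuous fun h : H => ‖representedSample h.1 z‖ₑ := by
      refine Continuous.enorm ((PiLp.continuous_toLp 2 _).comp (continuous_pi fun i => ?_))
      exact (continuous_apply (z i).1).comp continuous_subtype_val
    exact isClosed_property hd (isClosed_le hcont continuous_const)
      (fun k => le_iSup (fun k => ‖representedSample (d k).1 z‖ₑ) k) h

lemma mean_truncatedError_le (hT : 0 < T) {c : ℝ} (hc : 0 ≤ c) {d : ℕ → X → EuclideanSpace ℝ (Fin K)}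
    (hd : ∀ k, d k ∈ H) (Z : Fin T → Fin n → X × ℝ) :
    (((1 / (T : ℝ)) * ∑ t, (truncatedError c d (Z t)).toReal : ℝ) : EReal) ≤
      (c : EReal) *
        (((1 / T) * ∑ t, ⨆ h ∈ H, ‖representedSample h (Z t)‖ₑ : ENNReal) : EReal) := by
  have hT0 : (T : ENNReal) ≠ 0 := by exact_mod_cast hT.ne'
  have h1 : (1 / T : ENNReal) * ∑ t, truncatedError c d (Z t) ≤
      ENNReal.ofReal c * ((1 / T) * ∑ t, ⨆ h ∈ H, ‖representedSample h (Z t)‖ₑ) := by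
    rw [mul_left_comm, Finset.mul_sum (a := ENNReal.ofReal c)]
    gcongr with t
    refine (min_le_right _ _).trans (mul_le_mul_right (iSup_le fun k => ?_) _)
    exact le_iSup₂ (f := fun h (_ : h ∈ H) => ‖representedSample h (Z t)‖ₑ) (d k) (hd k)
  have h2 := EReal.coe_ennreal_le_coe_ennreal_iff.2 h1
  rw [EReal.coe_ennreal_mul (ENNReal.ofReal c), EReal.coe_ennreal_ofReal, max_eq_left hc] at h2
  refine le_trans (le_of_eq ?_) h2
  have hfin : (1 / T : ENNReal) * ∑ t, truncatedError c d (Z t) ≠ ⊤ :=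
    ENNReal.mul_ne_top (ENNReal.div_ne_top ENNReal.one_ne_top hT0)
      (ENNReal.sum_ne_top.2 fun t _ => truncatedError_ne_top)
  rw [← EReal.coe_ennreal_toReal hfin, ENNReal.toReal_mul,
    ENNReal.toReal_sum fun t _ => truncatedError_ne_top]
  simp

variable [MeasurableSpace X]

/-- With probability at least `1 - δ`, the excess risk of every solution is at most an empirical
Gaussian complexity plus the expected estimation error of specialization, up to the deviation of the
empirical mean of `V`. -/
theorem measure_excessRisk_le (hT : 0 < T) (hn : 0 < n)
    (hl_meas : Measurable fun p : ℝ × ℝ => l p.1 p.2)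
    (hl : ∀ u y, l u y ∈ Set.Icc (0 : ℝ) 1) (hl_lip : ∀ y, LipschitzWith 1 fun u => l u y)
    (hH_meas : ∀ h ∈ H, Measurable h) (hF_lip : ∀ f ∈ F, LipschitzWith L f)
    (hfhat : IsEmpiricalMinimizer l H F fhat)
    (hfhat_meas : ∀ h ∈ H, ∀ v, Measurable fun z => fhat h z v)
    (η : Measure (ProbabilityMeasure (X × ℝ))) [IsProbabilityMeasure η]
    {d : ℕ → H} (hd : DenseRange d)
    {u : ℕ → EuclideanSpace ℝ (Fin K) → ℝ} (hu : ∀ k, u k ∈ F)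
    (hu_dense : ∀ f ∈ F, ∃ φ : ℕ → ℕ, ∀ x,
      Filter.Tendsto (fun j => u (φ j) x) Filter.atTop (nhds (f x)))
    {V : (Fin n → X × ℝ) → ℝ} (hV : Measurable V) {b : ℝ} (hb : 0 ≤ b)
    (hVb : ∀ z, V z ∈ Set.Icc 0 b) {δ : ℝ} (hδ : 0 < δ) {s : ℝ} (hs0 : 0 ≤ s)
    (hs : (4 + b) ^ 2 / T * Real.log (1 / δ) ≤ 2 * s ^ 2) :
    WithProbAtLeast (Measure.pi fun _ : Fin T => sampleLaw n η) δ fun Z =>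
      ∀ hhat, IsMTRLSolution l H F Z hhat →
        environmentRisk l η fhat hhat - optimalRisk l η H F ≤
          2 / T * rademacherAverage (fun k t => minRisk l fhat (d k).1 (Z t)) +
          (∫ z, 2 / n * lossRademacher l u hhat z ∂(sampleLaw n η) +
            ((1 / (T : ℝ)) * ∑ t, V (Z t) - ∫ z, V z ∂(sampleLaw n η))) + s := by
  have hne : Nonempty H := ⟨d 0⟩
  have hmm : ∀ h ∈ H, Measurable (minRisk l fhat h) := fun h hh =>
    measurable_minRisk hl_meas hF_lip hfhat hh (hH_meas h hh) (hfhat_meas h hh)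
  have hmi : ∀ h ∈ H, Integrable (minRisk l fhat h) (sampleLaw n η) := fun h hh =>
    integrable_of_measurable_of_bound (hmm h hh) 1 fun z =>
      abs_le_one_of_mem_Icc (minRisk_mem_Icc hl h z)
  have hgm : ∀ k, Measurable (minRisk l fhat (d k).1) := fun k => hmm _ (d k).2
  have hg01 : ∀ k z, minRisk l fhat (d k).1 z ∈ Set.Icc (0 : ℝ) 1 := fun k z =>
    minRisk_mem_Icc hl _ z
  obtain ⟨E, hE, hprob, hdev⟩ := measure_uniform_deviation_ge (sampleLaw n η) hT hgm hg01 hV hb hVb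
    hδ hs0 hs
  have hMbdd : ∀ Z : Fin T → Fin n → X × ℝ, ∀ k,
      |(1 / (T : ℝ)) * ∑ t, minRisk l fhat (d k).1 (Z t)| ≤ 1 := fun Z k =>
    abs_le_one_of_mem_Icc (mean_mem_Icc fun t => hg01 k (Z t))
  have hMle : ∀ (Z : Fin T → Fin n → X × ℝ) (h : H),
      (⨅ k, (1 / (T : ℝ)) * ∑ t, minRisk l fhat (d k).1 (Z t)) ≤ meanMinRisk l fhat h.1 Z := by
    intro Z
    exact isClosed_property hd (isClosed_le continuous_const
      (continuous_meanMinRisk hl_lip hF_lip hfhat Z)) fun k =>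
        ciInf_le (bddBelow_range_of_abs_le (hMbdd Z)) k
  -- The mean of an infimum is at most the infimum of the means, and the mean for each `h` is at
  -- most its optimal risk.
  have hopt : ∫ Z, ⨅ k, (1 / (T : ℝ)) * ∑ t, minRisk l fhat (d k).1 (Z t)
      ∂(Measure.pi fun _ : Fin T => sampleLaw n η) ≤ optimalRisk l η H F := by
    refine le_ciInf fun h => le_trans ?_ (integral_minRisk_le hn hl_meas hl hl_lip hF_lip hfhat h.2
      (hH_meas _ h.2) (hfhat_meas _ h.2) hu hu_dense η)
    rw [← integral_mean_comp_eval hT (hmi h.1 h.2)]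
    refine integral_mono (integrable_of_measurable_of_bound (Measurable.iInf fun k =>
      (Finset.measurable_fun_sum _ fun t _ => (hgm k).comp (measurable_pi_apply t)).const_mul _) 1
      fun Z => abs_iInf_le (hMbdd Z)) ?_ fun Z => hMle Z h
    exact (integrable_finsetSum _ fun t _ => integrable_eval_pi (hmi h.1 h.2) t).const_mul _
  refine ⟨E, hE, hprob, fun Z hZ hhat hsol => ?_⟩
  have hh : hhat ∈ H := hsol.1
  have h1 := environmentRisk_le hn hl_meas hl hl_lip hF_lip hfhat hh (hH_meas _ hh)
    (hfhat_meas _ hh) hu hu_dense η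
  have h2 := integral_le_mean_add_integral_iSup (sampleLaw n η) hT (hmi hhat hh) (z := Z)
    (integrable_iSup_sum_sub (sampleLaw n η) hgm hg01 Z) fun Z' => by
      have hcl : ∀ h : H, ∑ t, (minRisk l fhat h.1 (Z' t) - minRisk l fhat h.1 (Z t)) ≤
          ⨆ k, ∑ t, (minRisk l fhat (d k).1 (Z' t) - minRisk l fhat (d k).1 (Z t)) :=
        isClosed_property hd (isClosed_le (continuous_finsetSum _ fun t _ =>
          (continuous_minRisk hl_lip hF_lip hfhat (Z' t)).sub
            (continuous_minRisk hl_lip hF_lip hfhat (Z t))) continuous_const) fun k =>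
          le_ciSup (bddAbove_range_of_abs_le (B := T) fun k =>
            abs_sum_sub_le_of_mem_Icc (fun t => hg01 k (Z' t)) fun t => hg01 k (Z t)) k
      exact hcl ⟨hhat, hh⟩
  -- The only use of optimality of `hhat`.
  have h3 : (1 / (T : ℝ)) * ∑ t, minRisk l fhat hhat (Z t) ≤
      ⨅ k, (1 / (T : ℝ)) * ∑ t, minRisk l fhat (d k).1 (Z t) :=
    le_ciInf fun k => meanMinRisk_le_of_isMTRLSolution hfhat hsol (d k).2
  have h4 := hdev Z hZ
  linarith

/-- The pointwise bound by the norm of the represented sample is integrated with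
`lintegral_enorm_representedSample_le`. Passing to positive parts allows the computation in
`ENNReal`, where the second moment may be infinite. -/
lemma integral_lossRademacher_le (hK : 0 < K) (hn : 0 < n)
    (hl_meas : Measurable fun p : ℝ × ℝ => l p.1 p.2)
    (hl : ∀ u y, l u y ∈ Set.Icc (0 : ℝ) 1) (hl_lip : ∀ y, LipschitzWith 1 fun u => l u y)
    (hF_lip : ∀ f ∈ F, LipschitzWith L f) {q : ℝ} (hq : qPrime n F = q) (hq0 : 0 ≤ q)
    {u : ℕ → EuclideanSpace ℝ (Fin K) → ℝ} (hu : ∀ k, u k ∈ F)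
    {h : X → EuclideanSpace ℝ (Fin K)} (hh : Measurable h)
    (η : Measure (ProbabilityMeasure (X × ℝ))) [IsProbabilityMeasure η] :
    ((∫ z, 2 / n * lossRademacher l u h z ∂(sampleLaw n η) : ℝ) : EReal) ≤
      ((√(2 * Real.pi) : ℝ) : EReal) * qPrime n F *
        ((((∫⁻ p, ‖h p.1‖ₑ ^ 2 ∂(mixture η)) / n) ^ (1 / 2 : ℝ) : ENNReal) : EReal) := by
  have hn' : (0 : ℝ) < n := by exact_mod_cast hn
  set c : ℝ := √(2 * Real.pi) / n * q with hc
  have hc0 : 0 ≤ c := by positivity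
  have hrm := measurable_lossRademacher (n := n) hl_meas
    (fun k => (hF_lip _ (hu k)).continuous) hh
  have hb : ∀ z : Fin n → X × ℝ, |2 / n * lossRademacher l u h z| ≤ 2 / n * n := fun z => by
    rw [abs_mul, abs_of_nonneg (by positivity)]
    exact mul_le_mul_of_nonneg_left (abs_lossRademacher_le hl u h z) (by positivity)
  have hi : Integrable (fun z : Fin n → X × ℝ => 2 / n * lossRademacher l u h z)
      (sampleLaw n η) := integrable_of_measurable_of_bound (hrm.const_mul _) _ hb
  have h1 : ENNReal.ofReal (∫ z, max (2 / n * lossRademacher l u h z) 0 ∂(sampleLaw n η)) ≤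
      ENNReal.ofReal (√(2 * Real.pi) * q) *
        ((∫⁻ p, ‖h p.1‖ₑ ^ 2 ∂(mixture η)) / n) ^ (1 / 2 : ℝ) := by
    rw [ofReal_integral_eq_lintegral_ofReal hi.pos_part
      (Filter.Eventually.of_forall fun z => le_max_right _ _)]
    calc ∫⁻ z, ENNReal.ofReal (max (2 / n * lossRademacher l u h z) 0) ∂(sampleLaw n η)
        ≤ ∫⁻ z, ENNReal.ofReal c * ‖representedSample h z‖ₑ ∂(sampleLaw n η) := by
          refine lintegral_mono fun z => ?_
          rw [← ofReal_norm, ← ENNReal.ofReal_mul hc0]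
          exact ENNReal.ofReal_le_ofReal (max_le
            (lossRademacher_le hK hn hl hl_lip hF_lip hq hu h z) (by positivity))
      _ = ENNReal.ofReal c * ∫⁻ z, ‖representedSample h z‖ₑ ∂(sampleLaw n η) :=
          lintegral_const_mul _ (measurable_enorm_representedSample hh)
      _ ≤ ENNReal.ofReal c * (n * ((∫⁻ p, ‖h p.1‖ₑ ^ 2 ∂(mixture η)) / n) ^ (1 / 2 : ℝ)) := by
          gcongr
          exact lintegral_enorm_representedSample_le hn hh η
      _ = _ := by
          rw [← mul_assoc, ← ENNReal.ofReal_natCast n, ← ENNReal.ofReal_mul hc0]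
          congr 2
          rw [hc]; field_simp
  rw [hq, ← EReal.coe_mul]
  have h2 : ∫ z, 2 / n * lossRademacher l u h z ∂(sampleLaw n η) ≤
      ∫ z, max (2 / n * lossRademacher l u h z) 0 ∂(sampleLaw n η) :=
    integral_mono hi hi.pos_part fun z => le_max_left _ _
  refine (EReal.coe_le_coe_iff.2 h2).trans ?_
  have h3 := EReal.coe_ennreal_le_coe_ennreal_iff.2 h1
  have h4 : 0 ≤ ∫ z, max (2 / n * lossRademacher l u h z) 0 ∂(sampleLaw n η) :=
    integral_nonneg fun z => le_max_right _ _
  rw [EReal.coe_ennreal_mul, EReal.coe_ennreal_ofReal, EReal.coe_ennreal_ofReal,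
    max_eq_left h4, max_eq_left (by positivity)] at h3
  exact h3

lemma measurable_toReal_truncatedError {c : ℝ} {d : ℕ → X → EuclideanSpace ℝ (Fin K)}
    (hd : ∀ k, Measurable (d k)) :
    Measurable fun z : Fin n → X × ℝ => (truncatedError c d z).toReal :=
  (measurable_const.min ((Measurable.iSup fun k =>
    measurable_enorm_representedSample (hd k)).const_mul _)).ennreal_toReal

end ExcessRisk

end

/-! ### The two excess risk bounds -/

theorem theorem2 {X : Type*} [MeasurableSpace X] {K T n : ℕ}
    (hK : 0 < K) (hT : 0 < T) (hn : 0 < n)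
    -- the loss function
    (l : ℝ → ℝ → ℝ) (hl_meas : Measurable fun p : ℝ × ℝ => l p.1 p.2)
    (hl_range : ∀ u y, l u y ∈ Set.Icc (0 : ℝ) 1)
    (hl_lip : ∀ y, LipschitzWith 1 fun u => l u y)
    -- the class of representations, separable for pointwise convergence
    (H : Set (X → EuclideanSpace ℝ (Fin K))) (hH_meas : ∀ h ∈ H, Measurable h)
    (hH_sep : TopologicalSpace.SeparableSpace H)
    -- the class of specialized predictors
    (F : Set (EuclideanSpace ℝ (Fin K) → ℝ)) (L : NNReal) (hL : 0 < L)
    (hF_lip : ∀ f ∈ F, LipschitzWith L f) (hF_q : qPrime n F ≠ ⊤)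
    -- the environment
    (η : Measure (ProbabilityMeasure (X × ℝ))) [IsProbabilityMeasure η]
    -- the empirical risk minimizers that specialize a representation to a new task
    (fhat : (X → EuclideanSpace ℝ (Fin K)) → (Fin n → X × ℝ) → EuclideanSpace ℝ (Fin K) → ℝ)
    (hfhat : IsEmpiricalMinimizer l H F fhat)
    (hfhat_meas : ∀ h ∈ H, ∀ v, Measurable fun z => fhat h z v)
    (δ : ℝ) (hδ : 0 < δ) :
    WithProbAtLeast (Measure.pi fun _ : Fin T => sampleLaw n η) δ (fun Z =>
      ∀ hhat, IsMTRLSolution l H F Z hhat →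
        ((environmentRisk l η fhat hhat - optimalRisk l η H F : ℝ) : EReal) ≤
          ((√(2 * Real.pi) * L / (T * √n) : ℝ) : EReal) * gaussianAverage (representationSet H Z)
          + ((√(2 * Real.pi) : ℝ) : EReal) * qPrime n F *
            ((⨆ h ∈ H, ((∫⁻ p, ‖h p.1‖ₑ ^ 2 ∂(mixture η)) / n) ^ (1 / 2 : ℝ) : ENNReal) : EReal)
          + ((√(8 * Real.log (4 / δ) / T) : ℝ) : EReal)) ∧
    WithProbAtLeast (Measure.pi fun _ : Fin T => sampleLaw n η) δ (fun Z =>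
      ∀ hhat, IsMTRLSolution l H F Z hhat →
        ((environmentRisk l η fhat hhat - optimalRisk l η H F : ℝ) : EReal) ≤
          ((√(2 * Real.pi) * L / (T * √n) : ℝ) : EReal) * gaussianAverage (representationSet H Z)
          + ((√(2 * Real.pi) / n : ℝ) : EReal) * qPrime n F *
            (((1 / T) * ∑ t, ⨆ h ∈ H, ‖representedSample h (Z t)‖ₑ : ENNReal) : EReal)
          + ((5 * √(Real.log (8 / δ) / T) : ℝ) : EReal)) := by
  -- Applied with b = 0, s = √8 (equality 16 = 16) and with b = 2, s = 5 (36 ≤ 50). The constants 4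
  -- and 8 inside the logarithms are slack. For large δ the logarithm may be negative; the square of
  -- the root is then 0, hence the maximum.
  have hdev : ∀ {b s a : ℝ}, 0 < a → (4 + b) ^ 2 ≤ 2 * s ^ 2 → 1 ≤ a → 0 ≤ s →
      (4 + b) ^ 2 / T * Real.log (1 / δ) ≤ 2 * (s * √(Real.log (a / δ) / T)) ^ 2 := by
    intro b s a ha0 hbs ha hs
    have hlog : Real.log (1 / δ) ≤ Real.log (a / δ) :=
      Real.log_le_log (by positivity) (by gcongr)
    have hT' : (0 : ℝ) < T := by exact_mod_cast hT
    rw [mul_pow, Real.sq_sqrt', div_mul_eq_mul_div, mul_div_assoc, ← mul_assoc]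
    exact mul_le_mul_of_nonneg hbs ((div_le_div_of_nonneg_right hlog hT'.le).trans
      (le_max_left _ _)) (sq_nonneg _) (le_max_right _ _)
  rcases H.eq_empty_or_nonempty with hH | ⟨h₀, hh₀⟩
  · have htriv : ∀ p : (Fin T → Fin n → X × ℝ) → Prop, (∀ Z, p Z) →
        WithProbAtLeast (Measure.pi fun _ : Fin T => sampleLaw n η) δ p := fun p hp =>
      ⟨Set.univ, MeasurableSet.univ, by
        rw [measure_univ, ENNReal.ofReal_le_one]; linarith, fun Z _ => hp Z⟩
    exact ⟨htriv _ fun Z hhat hs => absurd hs.1 (by simp [hH]),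
      htriv _ fun Z hhat hs => absurd hs.1 (by simp [hH])⟩
  have hne : Nonempty H := ⟨⟨h₀, hh₀⟩⟩
  obtain ⟨μ⟩ : Nonempty (ProbabilityMeasure (X × ℝ)) := nonempty_of_isProbabilityMeasure η
  obtain ⟨p₀⟩ : Nonempty (X × ℝ) := nonempty_of_isProbabilityMeasure (μ : Measure (X × ℝ))
  have hFne : F.Nonempty := ⟨_, (hfhat h₀ hh₀ fun _ => p₀).1⟩
  obtain ⟨u, hu, hu_dense⟩ := exists_seq_pointwise_dense (fun f hf => (hF_lip f hf).continuous) hFne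
  have hd := TopologicalSpace.denseRange_denseSeq H
  set d := TopologicalSpace.denseSeq H
  have hq0 : 0 ≤ qPrime n F := qPrime_nonneg hK hn hFne
  obtain ⟨q, hq⟩ : ∃ q : ℝ, qPrime n F = q := ⟨(qPrime n F).toReal, (EReal.coe_toReal hF_q
    (fun h => by simp [h] at hq0)).symm⟩
  have hq0' : 0 ≤ q := by rwa [hq, EReal.coe_nonneg] at hq0
  have hgauss : ∀ Z : Fin T → Fin n → X × ℝ, _ := fun Z =>
    rademacherAverage_minRisk_le hn hL hl_lip hF_lip hfhat (fun k => (d k).1) (fun k => (d k).2) Z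
  constructor
  · have hs : √(8 * Real.log (4 / δ) / T) = √8 * √(Real.log (4 / δ) / T) := by
      rw [mul_div_assoc, Real.sqrt_mul (by norm_num)]
    -- Here the estimation error stays an expectation, so `V` is zero.
    obtain ⟨E, hE, hprob, hbound⟩ := measure_excessRisk_le (b := 0) hT hn hl_meas hl_range hl_lip
      hH_meas hF_lip hfhat hfhat_meas η hd hu hu_dense (V := fun _ => 0) measurable_const le_rfl
      (fun _ => by simp) hδ (s := √(8 * Real.log (4 / δ) / T)) (Real.sqrt_nonneg _) (by
        rw [hs]
        exact hdev (by norm_num) (by rw [Real.sq_sqrt (by norm_num)]; norm_num) (by norm_num)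
          (Real.sqrt_nonneg _))
    refine ⟨E, hE, hprob, fun Z hZ hhat hsol => ?_⟩
    have h1 := hbound Z hZ hhat hsol
    simp only [Finset.sum_const_zero, mul_zero, integral_zero, sub_zero, add_zero] at h1
    refine (EReal.coe_le_coe_iff.2 h1).trans ?_
    rw [EReal.coe_add, EReal.coe_add]
    refine add_le_add (add_le_add (hgauss Z) ?_) le_rfl
    refine (integral_lossRademacher_le hK hn hl_meas hl_range hl_lip hF_lip hq hq0' hu
      (hH_meas _ hsol.1) η).trans (mul_le_mul_of_nonneg_left ?_
        (mul_nonneg (EReal.coe_nonneg.2 (Real.sqrt_nonneg _)) hq0))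
    exact EReal.coe_ennreal_le_coe_ennreal_iff.2 (le_iSup₂_of_le hhat hsol.1 le_rfl)
  · set c : ℝ := √(2 * Real.pi) / n * q with hc
    have hc0 : 0 ≤ c := by positivity
    have hVm : Measurable fun z : Fin n → X × ℝ =>
        (truncatedError c (fun k => (d k).1) z).toReal :=
      measurable_toReal_truncatedError fun k => hH_meas _ (d k).2
    obtain ⟨E, hE, hprob, hbound⟩ := measure_excessRisk_le (b := 2) hT hn hl_meas hl_range hl_lip
      hH_meas hF_lip hfhat hfhat_meas η hd hu hu_dense hVm zero_le_two
      (fun _ => toReal_truncatedError_mem_Icc) hδ (s := 5 * √(Real.log (8 / δ) / T))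
      (by positivity) (hdev (by norm_num) (by norm_num) (by norm_num) (by norm_num))
    refine ⟨E, hE, hprob, fun Z hZ hhat hsol => ?_⟩
    have h1 := hbound Z hZ hhat hsol
    -- The expected estimation error is at most the mean of `V`, which the deviation term subtracts;
    -- only the empirical mean of `V` survives.
    have h2 : ∫ z, 2 / n * lossRademacher l u hhat z ∂(sampleLaw n η) ≤
        ∫ z, (truncatedError c (fun k => (d k).1) z).toReal ∂(sampleLaw n η) := by
      refine integral_mono (integrable_of_measurable_of_bound ((measurable_lossRademacher hl_meas
        (fun k => (hF_lip _ (hu k)).continuous) (hH_meas _ hsol.1)).const_mul _) (2 / n * n)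
        fun z => ?_) (integrable_of_measurable_of_bound hVm 2 fun z => ?_) fun z =>
        lossRademacher_le_truncatedError hK hn hl_range hl_lip hF_lip hq hq0' hu hd
          ⟨hhat, hsol.1⟩ z
      · rw [abs_mul, abs_of_nonneg (by positivity)]
        exact mul_le_mul_of_nonneg_left (abs_lossRademacher_le hl_range u hhat z) (by positivity)
      · rw [abs_of_nonneg ENNReal.toReal_nonneg]
        exact toReal_truncatedError_mem_Icc.2
    have h3 : environmentRisk l η fhat hhat - optimalRisk l η H F ≤
        2 / T * rademacherAverage (fun k t => minRisk l fhat (d k).1 (Z t)) +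
          (1 / (T : ℝ)) * ∑ t, (truncatedError c (fun k => (d k).1) (Z t)).toReal +
          5 * √(Real.log (8 / δ) / T) := by linarith
    refine (EReal.coe_le_coe_iff.2 h3).trans ?_
    rw [EReal.coe_add, EReal.coe_add]
    refine add_le_add (add_le_add (hgauss Z) ?_) le_rfl
    rw [hq, ← EReal.coe_mul]
    exact mean_truncatedError_le hT hc0 (fun k => (d k).2) Z
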